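/- **Theorem.** Let $a,b,c>0$. A 3-arm in $\mathbb R^3$ with lengths $(a,b,c)$ is a sequence of points $R=(p_1,p_2,p_3,p_4)$ in $\mathbb R^3$ with $|p_1p_2|=a$, $|p_2p_3|=b$, $|p_3p_4|=c$; its arm vectors are $v_i=p_{i+1}-p_i$, and its signed volume is the determinant $V(R)=[v_1,v_2,v_3]$. The arm is degenerate if its four vertices lie in a plane. Let $M$ be the oriented moduli space, i.e. the space of all these 3-arms modulo the orientation-preserving isometries of $\mathbb R^3$, with the quotient topology; $V$ descends to a function $V:M\to\mathbb R$. Let $\mathrm{GRAM}\subset\mathbb R^3$ be the set of all points $(\langle v_2,v_3\rangle,\langle v_1,v_3\rangle,\langle v_1,v_2\rangle)$ given by these 3-arms, that is, the set of their Gram matrices (whose diagonal $(a^2,b^2,c^2)$ is fixed). Then: 1. $M$ is homeomorphic to the sphere $S^3$. 2. $M$ is obtained by gluing two copies of $\mathrm{GRAM}$ along their common boundary: there is a homeomorphism from $M$ onto the quotient of $\mathrm{GRAM}\sqcup\mathrm{GRAM}$ in which each point of the topological boundary $\partial\,\mathrm{GRAM}\subset\mathbb R^3$ in the first copy is identified with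 the same point in the second copy; it sends the class of an arm to its Gram point, in the first copy if $V\ge 0$ and in the second copy if $V\le 0$. The Gram point of an arm lies on $\partial\,\mathrm{GRAM}$ if and only if the arm is degenerate. 3. $V$ is an exact topological Morse function on $M$. Here a point $p$ is topologically regular for $f$ if there are local topological coordinates $x=(x_1,x_2,x_3)$ centred at $p$ in which $f=f(p)+x_i$ for some $i$; it is topologically critical otherwise; a critical point $p$ is a Morse critical point of index $k$ if there are local topological coordinates centred at $p$ in which $f=f(p)-x_1^2-\dots-x_k^2+x_{k+1}^2+\dots+x_3^2$; a continuous function $f$ is a topological Morse function if every point is topologically regular or a Morse critical point; and it is exact (perfect) if for every $k$ the number of its critical points of index $k$ is the $k$-th Betti number $\dim_{\mathbb Q}H_k(M;\mathbb Q)$ (singular homology). 4. $V$ has exactly two topologically critical points on $M$: a Morse critical point of index $3$, at which $V$ attains its global maximum, and a Morse critical point of index $0$, at which $V$ attains its global minimum. -/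

import Mathlib

noncomputable section

namespace RobotArm

/-- Euclidean space of dimension `d`. -/
abbrev E (d : ℕ) : Type := EuclideanSpace ℝ (Fin d)

/-- Orientation preserving isometries of Euclidean space (all surjective isometries are affine). -/
def OrientationPreserving {d : ℕ} (g : E d ≃ᵃⁱ[ℝ] E d) : Prop :=
  0 < LinearMap.det (g.linearIsometryEquiv.toLinearEquiv : E d →ₗ[ℝ] E d)

/-- The open chains `(p₁, …, pₙ₊₁)` in `ℝᵈ` with edge lengths `l₁, …, lₙ`, with the topology
inherited from `(ℝᵈ)ⁿ⁺¹`. -/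
abbrev Chain {n : ℕ} (l : Fin n → ℝ) (d : ℕ) : Type :=
  {p : Fin (n + 1) → E d // ∀ i : Fin n, dist (p i.castSucc) (p i.succ) = l i}

theorem OrientationPreserving.refl {d : ℕ} :
    OrientationPreserving (AffineIsometryEquiv.refl ℝ (E d)) := by
  have : ((AffineIsometryEquiv.refl ℝ (E d)).linearIsometryEquiv.toLinearEquiv :
      E d →ₗ[ℝ] E d) = LinearMap.id := by
    ext v; rfl
  rw [OrientationPreserving, this, LinearMap.det_id]
  exact one_pos

theorem OrientationPreserving.trans {d : ℕ} {g h : E d ≃ᵃⁱ[ℝ] E d}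
    (hg : OrientationPreserving g) (hh : OrientationPreserving h) :
    OrientationPreserving (g.trans h) := by
  have : ((g.trans h).linearIsometryEquiv.toLinearEquiv : E d →ₗ[ℝ] E d) =
      (h.linearIsometryEquiv.toLinearEquiv : E d →ₗ[ℝ] E d) ∘ₗ
        (g.linearIsometryEquiv.toLinearEquiv : E d →ₗ[ℝ] E d) := by
    ext v; rfl
  rw [OrientationPreserving, this, LinearMap.det_comp]
  exact mul_pos hh hg

theorem OrientationPreserving.symm {d : ℕ} {g : E d ≃ᵃⁱ[ℝ] E d}
    (hg : OrientationPreserving g) : OrientationPreserving g.symm := by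
  have h1 : OrientationPreserving (g.trans g.symm) := by
    rw [AffineIsometryEquiv.self_trans_symm]; exact OrientationPreserving.refl
  have : ((g.trans g.symm).linearIsometryEquiv.toLinearEquiv : E d →ₗ[ℝ] E d) =
      (g.symm.linearIsometryEquiv.toLinearEquiv : E d →ₗ[ℝ] E d) ∘ₗ
        (g.linearIsometryEquiv.toLinearEquiv : E d →ₗ[ℝ] E d) := by
    ext v; rfl
  rw [OrientationPreserving, this, LinearMap.det_comp] at h1
  exact pos_of_mul_pos_left h1 hg.le

/-- Two chains are equivalent if an orientation preserving isometry carries one to the other. -/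
instance chainSetoid {n : ℕ} (l : Fin n → ℝ) (d : ℕ) : Setoid (Chain l d) where
  r p q := ∃ g : E d ≃ᵃⁱ[ℝ] E d, OrientationPreserving g ∧ ∀ i, g (p.1 i) = q.1 i
  iseqv :=
    { refl := fun _ => ⟨AffineIsometryEquiv.refl ℝ (E d), OrientationPreserving.refl, fun _ => rfl⟩
      symm := fun {p q} ⟨g, hg, h⟩ =>
        ⟨g.symm, hg.symm, fun i => by rw [← h i, AffineIsometryEquiv.symm_apply_apply]⟩
      trans := fun {p q r} ⟨g, hg, h⟩ ⟨g', hg', h'⟩ =>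
        ⟨g.trans g', hg.trans hg', fun i => by
          rw [AffineIsometryEquiv.coe_trans, Function.comp_apply, h i, h' i]⟩ }

/-- The (oriented) moduli space of the robot arm with lengths `l` in `ℝᵈ`: chains modulo
orientation preserving isometries, with the quotient topology. -/
abbrev Moduli {n : ℕ} (l : Fin n → ℝ) (d : ℕ) : Type := Quotient (chainSetoid l d)

/-- The arm vectors of a chain. -/
def armVec {n d : ℕ} {l : Fin n → ℝ} (p : Chain l d) (i : Fin n) : E d :=
  p.1 i.succ - p.1 i.castSucc

/-- The signed volume `[a, b, c] = [a, a + b, a + b + c]` of a 3-arm with arm vectors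
`a`, `b`, `c`. -/
def chainVolume {l : Fin 3 → ℝ} (p : Chain l 3) : ℝ :=
  Matrix.det (Matrix.of fun i j : Fin 3 => armVec p i j)

theorem chainVolume_congr {l : Fin 3 → ℝ} (p q : Chain l 3) (h : p ≈ q) :
    chainVolume p = chainVolume q := by
  obtain ⟨g, hg, h⟩ := h
  have hdet : LinearMap.det (g.linearIsometryEquiv.toLinearEquiv : E 3 →ₗ[ℝ] E 3) = 1 := by
    have h1 : |LinearMap.det (g.linearIsometryEquiv.toLinearEquiv : E 3 →ₗ[ℝ] E 3)| = 1 := by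
      rw [← LinearMap.normDet_eq_abs_det]
      exact LinearIsometry.normDet_eq_one g.linearIsometryEquiv.toLinearIsometry
    rwa [abs_of_pos hg] at h1
  have key : ∀ r : Chain l 3, chainVolume r =
      (EuclideanSpace.basisFun (Fin 3) ℝ).toBasis.det (armVec r) := fun r => by
    rw [Module.Basis.det_apply, ← Matrix.det_transpose]
    rfl
  have harm : armVec q =
      (g.linearIsometryEquiv.toLinearEquiv : E 3 →ₗ[ℝ] E 3) ∘ armVec p := by
    funext i
    simp only [armVec, ← h, Function.comp_apply]
    exact (g.map_vsub (p.1 i.succ) (p.1 i.castSucc)).symm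
  rw [key, key, harm, Module.Basis.det_comp, hdet, one_mul]

/-- The signed volume as a function on the moduli space of 3-arms. -/
def volume (l : Fin 3 → ℝ) : Moduli l 3 → ℝ :=
  Quotient.lift chainVolume chainVolume_congr

/-- The free entries `(x, y, z) = (⟪b, c⟫, ⟪a, c⟫, ⟪a, b⟫)` of the Gram matrix of a 3-arm with
arm vectors `a`, `b`, `c`; the diagonal entries are the squares of the fixed lengths. -/
def gramPoint {l : Fin 3 → ℝ} (p : Chain l 3) : E 3 :=
  !₂[Matrix.gram ℝ (armVec p) 1 2, Matrix.gram ℝ (armVec p) 0 2, Matrix.gram ℝ (armVec p) 0 1]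

/-- The set of all Gram matrices of 3-arms with lengths `l`, as a subset of `ℝ³`. -/
def gramSet (l : Fin 3 → ℝ) : Set (E 3) :=
  Set.range (gramPoint : Chain l 3 → E 3)

/-- Two copies of a set `S`, with the points of their boundaries (topological frontiers)
identified. -/
inductive GlueRel {X : Type} [TopologicalSpace X] (S : Set X) : S ⊕ S → S ⊕ S → Prop
  | refl (u : S ⊕ S) : GlueRel S u u
  | inl_inr (s : S) (hs : (s : X) ∈ frontier S) : GlueRel S (Sum.inl s) (Sum.inr s)
  | inr_inl (s : S) (hs : (s : X) ∈ frontier S) : GlueRel S (Sum.inr s) (Sum.inl s)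

/-- The space obtained by gluing two copies of `S` along their common boundary, with the quotient
topology. -/
abbrev Double {X : Type} [TopologicalSpace X] (S : Set X) : Type := Quot (GlueRel S)

section Morse

variable {M : Type} [TopologicalSpace M]

/-- `p` is a topologically regular point of `f`: in suitable local (topological) coordinates `x`
centred at `p`, `f = f p + xᵢ`. -/
def IsTopRegularPoint (n : ℕ) (f : M → ℝ) (p : M) : Prop :=
  ∃ (φ : OpenPartialHomeomorph M (E n)) (i : Fin n), p ∈ φ.source ∧ φ p = 0 ∧
    ∀ x ∈ φ.source, f x = f p + φ x i

/-- `p` is a topologically critical point of `f`. -/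
def IsTopCriticalPoint (n : ℕ) (f : M → ℝ) (p : M) : Prop :=
  ¬ IsTopRegularPoint n f p

/-- `p` is a (topologically nondegenerate) Morse critical point of `f` of index `k`: in suitable
local coordinates `x` centred at `p`, `f = f p - x₁² - … - xₖ² + xₖ₊₁² + … + xₙ²`. -/
def IsMorseCriticalPoint (n : ℕ) (f : M → ℝ) (k : ℕ) (p : M) : Prop :=
  IsTopCriticalPoint n f p ∧ k ≤ n ∧
    ∃ φ : OpenPartialHomeomorph M (E n), p ∈ φ.source ∧ φ p = 0 ∧
      ∀ x ∈ φ.source, f x = f p + ∑ i : Fin n, if (i : ℕ) < k then -(φ x i) ^ 2 else (φ x i) ^ 2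

/-- A topological Morse function on an `n`-dimensional space: every point is either topologically
regular or a Morse critical point. -/
def IsTopMorse (n : ℕ) (f : M → ℝ) : Prop :=
  Continuous f ∧ ∀ p, IsTopRegularPoint n f p ∨ ∃ k, IsMorseCriticalPoint n f k p

/-- The `k`-th Betti number of a space: the dimension of its `k`-th singular homology with rational
coefficients (as a cardinal). -/
def bettiNumber (M : Type) [TopologicalSpace M] (k : ℕ) : Cardinal :=
  Module.rank ℚ (((AlgebraicTopology.singularHomologyFunctor (ModuleCat.{0} ℚ) k).obj
    (ModuleCat.of ℚ ℚ)).obj (TopCat.of M))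

/-- An exact (perfect) topological Morse function: the Morse inequalities are equalities, i.e. the
number of critical points of index `k` is the `k`-th Betti number, for every `k`. -/
def IsExactTopMorse (n : ℕ) (f : M → ℝ) : Prop :=
  IsTopMorse n f ∧ ∀ k, Cardinal.mk {p : M // IsMorseCriticalPoint n f k p} = bettiNumber M k

end Morse

end RobotArm

end

/-!
The space of arms, the double of the Gram set and the unit sphere of `ℝ⁴` are all identified with
one hypersurface. Dividing the free Gram entries of an arm by the products of the lengths gives a
point `x` of the elliptope, the set of positive semidefinite `3 × 3` matrices with unit diagonal,
and dividing the volume by the product of the lengths gives a number `v` with `v² = ellDet x`, the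
determinant of that matrix (`chainVolume_sq`). The pair `(x, v)` determines the arm up to
orientation preserving isometry (`chain_equiv_of_gramPoint_eq`): the Gram matrix determines it up to
isometry, the sign of the volume decides the orientation, and for zero volume a reflection fixing
the arm vectors is available. Every pair with `v² = ellDet x` occurs (`exists_chain`).

Inside the cube containing the elliptope, `ellDet` decreases strictly along rays from the origin
(`ellDet_lt_smul`), from `1` at the origin to a nonpositive value at the faces. Hence
`(x, v) ↦ (√(1 - v²) x / ‖x‖, v)` is a bijection from the hypersurface onto the sphere
(`sph_injOn`, `exists_sph_eq`) that turns the volume into the height. By compactness this yields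
homeomorphisms to the sphere from the moduli space (`moduliHomeo`) and from the double of the Gram
set (`doubleHomeo`), whose two sheets are the two square roots of `ellDet`. The same monotonicity
shows that the frontier of the elliptope is the zero set of the determinant
(`frontier_elliptope_iff`), that is, the image of the degenerate arms.

The volume is therefore a height function up to homeomorphism and a positive factor. Explicit
charts of the sphere show that its points other than the poles are regular and that the poles are
Morse critical points; an extremum can be neither regular nor a Morse point of another index
(`exactTopMorse_of_height`).

For exactness the rational Betti numbers of the sphere are computed from augmented singular chains.
Barycentric subdivision is defined on chains of ordered tuples by coning off the barycenter, and
transported to singular chains by naturality. It shows that a chain in a union of two open sets may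
be made small up to a boundary (`exists_eq_bd_add_small`), which gives the Mayer–Vietoris argument
on the level of elements (`AcyclicAt.union`, `SphericalAt.union`). The complement of the subspace of
`ℝᴺ` where the first `j + 1` coordinates vanish is the union of two star-shaped open sets meeting in
the corresponding complement for `j`, so its homology follows by induction
(`punctured_homology`). For `j = N` this complement is homotopy equivalent to the sphere, and the
chains are compared with Mathlib's singular chain complex degreewise (`singIso`).
-/

/-! ### Barycentric subdivision of ordered affine simplices -/

noncomputable section

namespace SphereHomology

/-- Formal rational combinations of ordered `m`-tuples of points of `P`. -/
abbrev TupleChain (P : Type*) (m : ℕ) : Type _ := (Fin m → P) →₀ ℚ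

namespace TupleChain

variable {P Q : Type*}

/-- The boundary of tuples. In length one it is the augmentation, its value being a multiple of
the empty tuple. -/
def bd (m : ℕ) : TupleChain P (m + 1) →ₗ[ℚ] TupleChain P m :=
  Finsupp.linearCombination ℚ fun v : Fin (m + 1) → P =>
    ∑ i : Fin (m + 1), (-1 : ℚ) ^ (i : ℕ) • Finsupp.single (v ∘ i.succAbove) (1 : ℚ)

/-- The cone with apex `p`: prepend `p` to every tuple. -/
def cone (p : P) (m : ℕ) : TupleChain P m →ₗ[ℚ] TupleChain P (m + 1) :=
  Finsupp.lmapDomain ℚ ℚ fun v => (Fin.cons p v : Fin (m + 1) → P)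

/-- The map induced on tuples by a map of points. -/
def map (f : P → Q) (m : ℕ) : TupleChain P m →ₗ[ℚ] TupleChain Q m :=
  Finsupp.lmapDomain ℚ ℚ fun v => f ∘ v

theorem bd_single (m : ℕ) (v : Fin (m + 1) → P) :
    bd m (Finsupp.single v 1) =
      ∑ i : Fin (m + 1), (-1 : ℚ) ^ (i : ℕ) • Finsupp.single (v ∘ i.succAbove) (1 : ℚ) := by
  simp [bd]

theorem cone_single (p : P) (m : ℕ) (v : Fin m → P) :
    cone p m (Finsupp.single v 1) = Finsupp.single (Fin.cons p v : Fin (m + 1) → P) 1 := by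
  simp [cone]

theorem map_single (f : P → Q) (m : ℕ) (v : Fin m → P) :
    map f m (Finsupp.single v 1) = Finsupp.single (f ∘ v) 1 := by
  simp [map]

theorem bd_cone_zero (p : P) (c : TupleChain P 0) : bd 0 (cone p 0 c) = c := by
  suffices h : bd 0 ∘ₗ cone p 0 = LinearMap.id from LinearMap.congr_fun h c
  refine Finsupp.lhom_ext' fun v => LinearMap.ext_ring ?_
  simp only [LinearMap.comp_apply, Finsupp.lsingle_apply, cone_single, bd_single]
  simp

/-- Coning is a contracting homotopy, which is what makes the recursion for subdivision work. -/
theorem bd_cone (p : P) (m : ℕ) (c : TupleChain P (m + 1)) :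
    bd (m + 1) (cone p (m + 1) c) = c - cone p m (bd m c) := by
  suffices h : bd (m + 1) ∘ₗ cone p (m + 1) = LinearMap.id - cone p m ∘ₗ bd m from
    LinearMap.congr_fun h c
  refine Finsupp.lhom_ext' fun v => LinearMap.ext_ring ?_
  simp only [LinearMap.comp_apply, Finsupp.lsingle_apply, cone_single, bd_single,
    LinearMap.sub_apply, LinearMap.id_apply, map_sum, map_smul]
  rw [Fin.sum_univ_succ, sub_eq_add_neg, ← Finset.sum_neg_distrib]
  congr 1
  · simp only [Fin.val_zero, pow_zero, one_smul]
    congr 1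
  · refine Finset.sum_congr rfl fun i _ => ?_
    rw [Fin.val_succ, pow_succ, mul_neg_one, neg_smul]
    congr 3
    funext j
    refine Fin.cases ?_ (fun k => ?_) j
    · simp
    · simp

theorem bd_bd (m : ℕ) (c : TupleChain P (m + 2)) : bd m (bd (m + 1) c) = 0 := by
  suffices h : bd m ∘ₗ bd (m + 1) = (0 : TupleChain P (m + 2) →ₗ[ℚ] TupleChain P m) from
    LinearMap.congr_fun h c
  induction m with
  | zero =>
    refine Finsupp.lhom_ext' fun v => LinearMap.ext_ring ?_
    have hv : Finsupp.lsingle (R := ℚ) v 1 = cone (v 0) 1 (Finsupp.single (Fin.tail v) 1) := by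
      rw [cone_single, Fin.cons_self_tail]; rfl
    rw [LinearMap.comp_apply, LinearMap.comp_apply, hv, bd_cone, map_sub, bd_cone_zero, sub_self]
    rfl
  | succ m ih =>
    refine Finsupp.lhom_ext' fun v => LinearMap.ext_ring ?_
    have hv : Finsupp.lsingle (R := ℚ) v 1 =
        cone (v 0) (m + 2) (Finsupp.single (Fin.tail v) 1) := by
      rw [cone_single, Fin.cons_self_tail]; rfl
    have h := fun c => LinearMap.congr_fun (ih c) c
    simp only [LinearMap.comp_apply, LinearMap.zero_apply] at h
    rw [LinearMap.comp_apply, LinearMap.comp_apply, hv, bd_cone, map_sub, bd_cone, h, map_zero,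
      sub_zero, sub_self]
    rfl

theorem map_cone (f : P → Q) (p : P) (m : ℕ) (c : TupleChain P m) :
    map f (m + 1) (cone p m c) = cone (f p) m (map f m c) := by
  suffices h : map f (m + 1) ∘ₗ cone p m = cone (f p) m ∘ₗ map f m from LinearMap.congr_fun h c
  refine Finsupp.lhom_ext' fun v => LinearMap.ext_ring ?_
  simp only [LinearMap.comp_apply, Finsupp.lsingle_apply, cone_single, map_single]
  congr 1
  funext j
  refine Fin.cases ?_ (fun k => ?_) j <;> simp

theorem map_bd (f : P → Q) (m : ℕ) (c : TupleChain P (m + 1)) :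
    map f m (bd m c) = bd m (map f (m + 1) c) := by
  suffices h : map f m ∘ₗ bd m = bd m ∘ₗ map f (m + 1) from LinearMap.congr_fun h c
  refine Finsupp.lhom_ext' fun v => LinearMap.ext_ring ?_
  simp only [LinearMap.comp_apply, Finsupp.lsingle_apply, bd_single, map_single, map_sum,
    map_smul, Function.comp_assoc]

/-- Barycentric subdivision with respect to a choice `b` of a barycenter for every tuple. -/
def sd (b : ∀ m, (Fin (m + 1) → P) → P) : ∀ m, TupleChain P m →ₗ[ℚ] TupleChain P m
  | 0 => LinearMap.id
  | m + 1 => Finsupp.linearCombination ℚ fun v : Fin (m + 1) → P =>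
      cone (b m v) m (sd b m (bd m (Finsupp.single v 1)))

/-- The chain homotopy from barycentric subdivision to the identity. -/
def sdHtpy (b : ∀ m, (Fin (m + 1) → P) → P) : ∀ m, TupleChain P m →ₗ[ℚ] TupleChain P (m + 1)
  | 0 => 0
  | m + 1 => Finsupp.linearCombination ℚ fun v : Fin (m + 1) → P =>
      cone (b m v) (m + 1) (Finsupp.single v 1 - sdHtpy b m (bd m (Finsupp.single v 1)))

variable (b : ∀ m, (Fin (m + 1) → P) → P)

theorem sd_single (m : ℕ) (v : Fin (m + 1) → P) :
    sd b (m + 1) (Finsupp.single v 1) = cone (b m v) m (sd b m (bd m (Finsupp.single v 1))) := by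
  rw [sd, Finsupp.linearCombination_single, one_smul]

theorem sdHtpy_single (m : ℕ) (v : Fin (m + 1) → P) :
    sdHtpy b (m + 1) (Finsupp.single v 1) =
      cone (b m v) (m + 1) (Finsupp.single v 1 - sdHtpy b m (bd m (Finsupp.single v 1))) := by
  rw [sdHtpy, Finsupp.linearCombination_single, one_smul]

theorem bd_sd (m : ℕ) (c : TupleChain P (m + 1)) :
    bd m (sd b (m + 1) c) = sd b m (bd m c) := by
  suffices h : bd m ∘ₗ sd b (m + 1) = sd b m ∘ₗ bd m from LinearMap.congr_fun h c
  refine Finsupp.lhom_ext' fun v => LinearMap.ext_ring ?_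
  simp only [LinearMap.comp_apply, Finsupp.lsingle_apply, sd_single]
  cases m with
  | zero => exact bd_cone_zero _ _
  | succ m => rw [bd_cone, bd_sd m, bd_bd, map_zero, map_zero, sub_zero]

theorem bd_sdHtpy (m : ℕ) (c : TupleChain P (m + 1)) :
    bd (m + 1) (sdHtpy b (m + 1) c) = c - sd b (m + 1) c - sdHtpy b m (bd m c) := by
  suffices h : bd (m + 1) ∘ₗ sdHtpy b (m + 1) =
      LinearMap.id - sd b (m + 1) - sdHtpy b m ∘ₗ bd m from LinearMap.congr_fun h c
  refine Finsupp.lhom_ext' fun v => LinearMap.ext_ring ?_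
  simp only [LinearMap.comp_apply, Finsupp.lsingle_apply, LinearMap.sub_apply,
    LinearMap.id_apply, sdHtpy_single, bd_cone, sd_single, map_sub]
  cases m with
  | zero => simp [sdHtpy, sd]
  | succ m =>
    rw [bd_sdHtpy m, bd_bd, map_zero]
    simp only [map_sub, map_zero]
    abel

variable {b} {b' : ∀ m, (Fin (m + 1) → Q) → Q}

/-- Subdivision is natural for the maps of points that preserve barycenters. -/
theorem map_sd {f : P → Q} (hf : ∀ m v, f (b m v) = b' m (f ∘ v)) (m : ℕ) (c : TupleChain P m) :
    map f m (sd b m c) = sd b' m (map f m c) := by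
  induction m with
  | zero => rfl
  | succ m ih =>
    suffices h : map f (m + 1) ∘ₗ sd b (m + 1) = sd b' (m + 1) ∘ₗ map f (m + 1) from
      LinearMap.congr_fun h c
    refine Finsupp.lhom_ext' fun v => LinearMap.ext_ring ?_
    simp only [LinearMap.comp_apply, Finsupp.lsingle_apply, sd_single, map_cone, map_single, ih,
      map_bd, hf]

theorem map_sdHtpy {f : P → Q} (hf : ∀ m v, f (b m v) = b' m (f ∘ v)) (m : ℕ)
    (c : TupleChain P m) :
    map f (m + 1) (sdHtpy b m c) = sdHtpy b' m (map f m c) := by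
  induction m with
  | zero => simp [sdHtpy]
  | succ m ih =>
    suffices h : map f (m + 2) ∘ₗ sdHtpy b (m + 1) = sdHtpy b' (m + 1) ∘ₗ map f (m + 1) from
      LinearMap.congr_fun h c
    refine Finsupp.lhom_ext' fun v => LinearMap.ext_ring ?_
    simp only [LinearMap.comp_apply, Finsupp.lsingle_apply, sdHtpy_single, map_cone, map_single,
      map_sub, ih, map_bd, hf]

end TupleChain

end SphereHomology

end

/-! ### Augmented singular chains and their subdivision -/

noncomputable section

namespace SphereHomology

/-- The standard simplex with `m` vertices; it is empty for `m = 0`. -/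
abbrev Simp (m : ℕ) : Type := stdSimplex ℝ (Fin m)

/-- Singular chains with rational coefficients, indexed by the number `m` of vertices (so by the
dimension plus one). For `m = 0` the only simplex is the empty one, whence the chain complex is the
augmented one. -/
abbrev SingChain (X : Type*) [TopologicalSpace X] (m : ℕ) : Type _ := C(Simp m, X) →₀ ℚ

/-- The inclusion of the `i`-th face. -/
def face (m : ℕ) (i : Fin (m + 1)) : C(Simp m, Simp (m + 1)) :=
  ⟨stdSimplex.map i.succAbove, stdSimplex.continuous_map _⟩

/-- The affine map of simplices with given images of the vertices. -/
def affineSimp {m n : ℕ} (v : Fin m → Simp n) : C(Simp m, Simp n) where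
  toFun t := ⟨fun j => ∑ i, t i * v i j,
    fun j => Finset.sum_nonneg fun i _ => mul_nonneg (t.2.1 i) ((v i).2.1 j), by
      rw [Finset.sum_comm]
      simp [← Finset.mul_sum]⟩
  continuous_toFun := by
    refine Continuous.subtype_mk (continuous_pi fun j => continuous_finsetSum _ fun i _ => ?_) _
    exact ((continuous_apply i).comp continuous_subtype_val).mul continuous_const

theorem affineSimp_apply {m n : ℕ} (v : Fin m → Simp n) (t : Simp m) (j : Fin n) :
    affineSimp v t j = ∑ i, t i * v i j := rfl

theorem affineSimp_comp {k m n : ℕ} (v : Fin m → Simp n) (w : Fin k → Simp m) :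
    (affineSimp v).comp (affineSimp w) = affineSimp (affineSimp v ∘ w) := by
  ext t j
  simp only [ContinuousMap.comp_apply]
  simp only [affineSimp_apply, Function.comp_apply, Finset.sum_mul, Finset.mul_sum, mul_assoc]
  exact Finset.sum_comm

theorem affineSimp_vertex (m : ℕ) :
    affineSimp (stdSimplex.vertex : Fin m → Simp m) = ContinuousMap.id _ := by
  ext t j
  simp [affineSimp_apply, Pi.single_apply]

theorem affineSimp_apply_vertex {m n : ℕ} (v : Fin m → Simp n) (i : Fin m) :
    affineSimp v (stdSimplex.vertex i) = v i := by
  ext j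
  simp [affineSimp_apply, Pi.single_apply]

theorem face_eq (m : ℕ) (i : Fin (m + 1)) :
    face m i = affineSimp (stdSimplex.vertex ∘ i.succAbove) := by
  ext t j
  change FunOnFinite.linearMap ℝ ℝ i.succAbove t j = _
  rw [FunOnFinite.linearMap_apply_apply, affineSimp_apply, Finset.sum_filter]
  refine Finset.sum_congr rfl fun k _ => ?_
  simp [Pi.single_apply, eq_comm]

/-- The barycenter of the points of a tuple. -/
def bary {n : ℕ} (m : ℕ) (v : Fin (m + 1) → Simp n) : Simp n :=
  affineSimp v stdSimplex.barycenter

theorem affineSimp_bary {n k : ℕ} (w : Fin n → Simp k) (m : ℕ) (v : Fin (m + 1) → Simp n) :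
    affineSimp w (bary m v) = bary m (affineSimp w ∘ v) := by
  rw [bary, bary, ← affineSimp_comp]; rfl

namespace SingChain

variable {X Y Z : Type*} [TopologicalSpace X] [TopologicalSpace Y] [TopologicalSpace Z]

/-- The boundary of singular chains; in the lowest degree it is the augmentation. -/
def bd (m : ℕ) : SingChain X (m + 1) →ₗ[ℚ] SingChain X m :=
  Finsupp.linearCombination ℚ fun σ : C(Simp (m + 1), X) =>
    ∑ i : Fin (m + 1), (-1 : ℚ) ^ (i : ℕ) • Finsupp.single (σ.comp (face m i)) (1 : ℚ)

/-- The map induced on singular chains by a continuous map. -/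
def push (f : C(X, Y)) (m : ℕ) : SingChain X m →ₗ[ℚ] SingChain Y m :=
  Finsupp.lmapDomain ℚ ℚ f.comp

/-- The chain of affine simplices given by a chain of tuples. -/
def ofTuple (n m : ℕ) : TupleChain (Simp n) m →ₗ[ℚ] SingChain (Simp n) m :=
  Finsupp.lmapDomain ℚ ℚ affineSimp

theorem bd_single (m : ℕ) (σ : C(Simp (m + 1), X)) :
    bd m (Finsupp.single σ 1) =
      ∑ i : Fin (m + 1), (-1 : ℚ) ^ (i : ℕ) • Finsupp.single (σ.comp (face m i)) (1 : ℚ) := by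
  simp [bd]

theorem push_single (f : C(X, Y)) (m : ℕ) (σ : C(Simp m, X)) :
    push f m (Finsupp.single σ 1) = Finsupp.single (f.comp σ) 1 := by
  simp [push]

theorem ofTuple_single {n m : ℕ} (v : Fin m → Simp n) :
    ofTuple n m (Finsupp.single v 1) = Finsupp.single (affineSimp v) 1 := by
  simp [ofTuple]

theorem push_push (g : C(Y, Z)) (f : C(X, Y)) (m : ℕ) (c : SingChain X m) :
    push g m (push f m c) = push (g.comp f) m c := by
  suffices h : push g m ∘ₗ push f m = push (g.comp f) m from LinearMap.congr_fun h c
  refine Finsupp.lhom_ext' fun v => LinearMap.ext_ring ?_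
  simp only [LinearMap.comp_apply, Finsupp.lsingle_apply, push_single, ContinuousMap.comp_assoc]

theorem push_bd (f : C(X, Y)) (m : ℕ) (c : SingChain X (m + 1)) :
    push f m (bd m c) = bd m (push f (m + 1) c) := by
  suffices h : push f m ∘ₗ bd m = bd m ∘ₗ push f (m + 1) from LinearMap.congr_fun h c
  refine Finsupp.lhom_ext' fun v => LinearMap.ext_ring ?_
  simp only [LinearMap.comp_apply, Finsupp.lsingle_apply, bd_single, push_single, map_sum,
    map_smul, ContinuousMap.comp_assoc]

theorem ofTuple_bd {n : ℕ} (m : ℕ) (c : TupleChain (Simp n) (m + 1)) :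
    ofTuple n m (TupleChain.bd m c) = bd m (ofTuple n (m + 1) c) := by
  suffices h : ofTuple n m ∘ₗ TupleChain.bd m = bd m ∘ₗ ofTuple n (m + 1) from
    LinearMap.congr_fun h c
  refine Finsupp.lhom_ext' fun v => LinearMap.ext_ring ?_
  simp only [LinearMap.comp_apply, Finsupp.lsingle_apply, bd_single, TupleChain.bd_single,
    ofTuple_single, map_sum, map_smul]
  refine Finset.sum_congr rfl fun i _ => ?_
  rw [face_eq, affineSimp_comp]
  congr 3
  funext j
  exact (affineSimp_apply_vertex v _).symm

theorem ofTuple_map {n k : ℕ} (w : Fin n → Simp k) (m : ℕ) (c : TupleChain (Simp n) m) :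
    ofTuple k m (TupleChain.map (affineSimp w) m c) = push (affineSimp w) m (ofTuple n m c) := by
  suffices h : ofTuple k m ∘ₗ TupleChain.map (affineSimp w) m =
      push (affineSimp w) m ∘ₗ ofTuple n m from LinearMap.congr_fun h c
  refine Finsupp.lhom_ext' fun v => LinearMap.ext_ring ?_
  simp only [LinearMap.comp_apply, Finsupp.lsingle_apply, push_single, TupleChain.map_single,
    ofTuple_single, affineSimp_comp]

/-- The tuple of all vertices of the standard simplex. -/
def vertices (m : ℕ) : TupleChain (Simp m) m := Finsupp.single stdSimplex.vertex 1

theorem map_vertices {m n : ℕ} (v : Fin m → Simp n) :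
    TupleChain.map (affineSimp v) m (vertices m) = Finsupp.single v 1 := by
  rw [vertices, TupleChain.map_single]
  congr 1
  funext i
  exact affineSimp_apply_vertex v i

/-- Every singular simplex is the image of the identity simplex. Identities between natural
operators are thereby reduced to chains of affine simplices. -/
theorem push_ofTuple_vertices (m : ℕ) (σ : C(Simp m, X)) :
    push σ m (ofTuple m m (vertices m)) = Finsupp.single σ 1 := by
  rw [vertices, ofTuple_single, push_single, affineSimp_vertex]
  rfl

theorem bd_bd (m : ℕ) (c : SingChain X (m + 2)) : bd m (bd (m + 1) c) = 0 := by
  suffices h : bd m ∘ₗ bd (m + 1) = (0 : SingChain X (m + 2) →ₗ[ℚ] SingChain X m) from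
    LinearMap.congr_fun h c
  refine Finsupp.lhom_ext' fun σ => LinearMap.ext_ring ?_
  simp only [LinearMap.comp_apply, Finsupp.lsingle_apply]
  rw [← push_ofTuple_vertices, ← push_bd, ← push_bd, ← ofTuple_bd, ← ofTuple_bd,
    TupleChain.bd_bd, map_zero, map_zero]
  rfl

/-- Barycentric subdivision of singular chains. -/
def sd (m : ℕ) : SingChain X m →ₗ[ℚ] SingChain X m :=
  Finsupp.linearCombination ℚ fun σ : C(Simp m, X) =>
    push σ m (ofTuple m m (TupleChain.sd bary m (vertices m)))

/-- The chain homotopy from subdivision of singular chains to the identity. -/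
def sdHtpy (m : ℕ) : SingChain X m →ₗ[ℚ] SingChain X (m + 1) :=
  Finsupp.linearCombination ℚ fun σ : C(Simp m, X) =>
    push σ (m + 1) (ofTuple m (m + 1) (TupleChain.sdHtpy bary m (vertices m)))

theorem sd_single (m : ℕ) (σ : C(Simp m, X)) :
    sd m (Finsupp.single σ 1) =
      push σ m (ofTuple m m (TupleChain.sd bary m (vertices m))) := by
  simp [sd]

theorem sdHtpy_single (m : ℕ) (σ : C(Simp m, X)) :
    sdHtpy m (Finsupp.single σ 1) =
      push σ (m + 1) (ofTuple m (m + 1) (TupleChain.sdHtpy bary m (vertices m))) := by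
  simp [sdHtpy]

theorem push_sd (f : C(X, Y)) (m : ℕ) (c : SingChain X m) :
    push f m (sd m c) = sd m (push f m c) := by
  suffices h : push f m ∘ₗ sd m = sd m ∘ₗ push f m from LinearMap.congr_fun h c
  refine Finsupp.lhom_ext' fun v => LinearMap.ext_ring ?_
  simp only [LinearMap.comp_apply, Finsupp.lsingle_apply, sd_single, push_single, push_push]

theorem push_sdHtpy (f : C(X, Y)) (m : ℕ) (c : SingChain X m) :
    push f (m + 1) (sdHtpy m c) = sdHtpy m (push f m c) := by
  suffices h : push f (m + 1) ∘ₗ sdHtpy m = sdHtpy m ∘ₗ push f m from LinearMap.congr_fun h c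
  refine Finsupp.lhom_ext' fun v => LinearMap.ext_ring ?_
  simp only [LinearMap.comp_apply, Finsupp.lsingle_apply, sdHtpy_single, push_single, push_push]

theorem sd_ofTuple {n : ℕ} (m : ℕ) (c : TupleChain (Simp n) m) :
    sd m (ofTuple n m c) = ofTuple n m (TupleChain.sd bary m c) := by
  suffices h : sd m ∘ₗ ofTuple n m = ofTuple n m ∘ₗ TupleChain.sd bary m from
    LinearMap.congr_fun h c
  refine Finsupp.lhom_ext' fun v => LinearMap.ext_ring ?_
  simp only [LinearMap.comp_apply, Finsupp.lsingle_apply, ofTuple_single, sd_single]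
  rw [← ofTuple_map, TupleChain.map_sd (b' := bary) (affineSimp_bary v), map_vertices]

theorem sdHtpy_ofTuple {n : ℕ} (m : ℕ) (c : TupleChain (Simp n) m) :
    sdHtpy m (ofTuple n m c) = ofTuple n (m + 1) (TupleChain.sdHtpy bary m c) := by
  suffices h : sdHtpy m ∘ₗ ofTuple n m = ofTuple n (m + 1) ∘ₗ TupleChain.sdHtpy bary m from
    LinearMap.congr_fun h c
  refine Finsupp.lhom_ext' fun v => LinearMap.ext_ring ?_
  simp only [LinearMap.comp_apply, Finsupp.lsingle_apply, ofTuple_single, sdHtpy_single]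
  rw [← ofTuple_map, TupleChain.map_sdHtpy (b' := bary) (affineSimp_bary v), map_vertices]

theorem bd_sd (m : ℕ) (c : SingChain X (m + 1)) : bd m (sd (m + 1) c) = sd m (bd m c) := by
  suffices h : bd m ∘ₗ sd (m + 1) = sd m ∘ₗ bd m (X := X) from LinearMap.congr_fun h c
  refine Finsupp.lhom_ext' fun σ => LinearMap.ext_ring ?_
  simp only [LinearMap.comp_apply, Finsupp.lsingle_apply]
  rw [← push_ofTuple_vertices, ← push_sd, ← push_bd, ← push_bd, ← push_sd, sd_ofTuple,
    ← ofTuple_bd, ← ofTuple_bd, sd_ofTuple, TupleChain.bd_sd]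

theorem bd_sdHtpy (m : ℕ) (c : SingChain X (m + 1)) :
    bd (m + 1) (sdHtpy (m + 1) c) = c - sd (m + 1) c - sdHtpy m (bd m c) := by
  suffices h : bd (m + 1) ∘ₗ sdHtpy (m + 1) =
      LinearMap.id - sd (m + 1) - sdHtpy m ∘ₗ bd m (X := X) from LinearMap.congr_fun h c
  refine Finsupp.lhom_ext' fun σ => LinearMap.ext_ring ?_
  simp only [LinearMap.comp_apply, Finsupp.lsingle_apply, LinearMap.sub_apply, LinearMap.id_apply]
  rw [← push_ofTuple_vertices, ← push_sd, ← push_bd, ← push_sdHtpy, ← push_sdHtpy, ← push_bd,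
    sdHtpy_ofTuple, sd_ofTuple, ← ofTuple_bd, ← ofTuple_bd, sdHtpy_ofTuple,
    TupleChain.bd_sdHtpy]
  simp only [map_sub]

end SingChain

end SphereHomology

end

/-! ### Subdivision makes simplices small -/

noncomputable section

namespace SphereHomology

open Set Filter Topology

/-- A linear map sends chains supported on `S` into a submodule as soon as it does so for the
simplices in `S`. -/
theorem map_mem_of_mem_supported {α M : Type*} [AddCommGroup M] [Module ℚ M] {S : Set α}
    {N : Submodule ℚ M} (L : (α →₀ ℚ) →ₗ[ℚ] M) (h : ∀ v ∈ S, L (Finsupp.single v 1) ∈ N)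
    {c : α →₀ ℚ} (hc : c ∈ Finsupp.supported ℚ ℚ S) : L c ∈ N := by
  rw [Finsupp.supported_eq_span_single] at hc
  refine (Submodule.span_le (p := N.comap L)).2 ?_ hc
  rintro _ ⟨v, hv, rfl⟩
  exact h v hv

theorem bary_apply {n m : ℕ} (v : Fin (m + 1) → Simp n) (j : Fin n) :
    bary m v j = (m + 1 : ℝ)⁻¹ * ∑ k, v k j := by
  rw [bary, affineSimp_apply, Finset.mul_sum]
  refine Finset.sum_congr rfl fun k _ => ?_
  congr 1
  change (stdSimplex.barycenter : stdSimplex ℝ (Fin (m + 1))).val k = _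
  simp

theorem affineSimp_mem_convexHull {n m : ℕ} (v : Fin m → Simp n) (t : Simp m) :
    (affineSimp v t : Fin n → ℝ) ∈ convexHull ℝ (range fun i => (v i : Fin n → ℝ)) := by
  have : (affineSimp v t : Fin n → ℝ) = ∑ i, t i • (v i : Fin n → ℝ) := by
    funext j
    rw [affineSimp_apply, Finset.sum_apply]
    rfl
  rw [this]
  exact (convex_convexHull ℝ _).sum_mem (fun i _ => t.2.1 i) t.2.2
    fun i _ => subset_convexHull ℝ _ ⟨i, rfl⟩

/-- The barycenter of `m + 1` points of diameter at most `r` is `r * m / (m + 1)`-close to each of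
them. -/
theorem dist_bary_le {n m : ℕ} (v : Fin (m + 1) → Simp n) {r : ℝ}
    (hr : ∀ i j, dist (v i) (v j) ≤ r) (i : Fin (m + 1)) :
    dist (bary m v) (v i) ≤ m / (m + 1) * r := by
  have hr0 : 0 ≤ r := dist_nonneg.trans (hr i i)
  rw [Subtype.dist_eq, dist_pi_le_iff (by positivity)]
  intro j
  have hj : ∀ k, |v k j - v i j| ≤ if k = i then 0 else r := by
    intro k
    split_ifs with h
    · simp [h]
    · have := (dist_le_pi_dist (v k : Fin n → ℝ) (v i) j).trans (hr k i)
      rwa [Real.dist_eq] at this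
  have hsum : ∑ k : Fin (m + 1), (if k = i then 0 else r) = m * r := by
    have : ∀ k : Fin (m + 1), (if k = i then 0 else r) = r - if k = i then r else 0 := by
      intro k; split_ifs <;> simp
    simp only [this, Finset.sum_sub_distrib]
    simp
    ring
  have hb : bary m v j - v i j = (m + 1 : ℝ)⁻¹ * ∑ k, (v k j - v i j) := by
    rw [bary_apply, Finset.sum_sub_distrib]
    simp
    field_simp
  change |bary m v j - v i j| ≤ _
  rw [hb, abs_mul, abs_of_nonneg (by positivity)]
  calc (m + 1 : ℝ)⁻¹ * |∑ k, (v k j - v i j)|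
      ≤ (m + 1 : ℝ)⁻¹ * ∑ k, |v k j - v i j| := by
        gcongr; exact Finset.abs_sum_le_sum_abs _ _
    _ ≤ (m + 1 : ℝ)⁻¹ * (m * r) := by
        gcongr; rw [← hsum]; exact Finset.sum_le_sum fun k _ => hj k
    _ = m / (m + 1) * r := by ring

/-- The tuples of diameter at most `r`. -/
def smallTuples (n m : ℕ) (r : ℝ) : Set (Fin m → Simp n) := {v | ∀ i j, dist (v i) (v j) ≤ r}

/-- Subdividing a simplex with `m` vertices yields simplices in its convex hull, of diameter
smaller by the factor `m / (m + 1)`. -/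
theorem sd_mem_supported {n : ℕ} (m : ℕ) (v : Fin m → Simp n) {r : ℝ} (hr0 : 0 ≤ r)
    (hr : v ∈ smallTuples n m r) :
    TupleChain.sd bary m (Finsupp.single v 1) ∈ Finsupp.supported ℚ ℚ
      {τ | (∀ i, (τ i : Fin n → ℝ) ∈ convexHull ℝ (range fun j => (v j : Fin n → ℝ))) ∧
        τ ∈ smallTuples n m (m / (m + 1) * r)} := by
  induction m with
  | zero =>
    exact Finsupp.single_mem_supported _ _ ⟨fun i => i.elim0, fun i => i.elim0⟩
  | succ m ih =>
    rw [TupleChain.sd_single, TupleChain.bd_single, map_sum, map_sum]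
    refine Submodule.sum_mem _ fun i _ => ?_
    rw [map_smul, map_smul]
    refine Submodule.smul_mem _ _ ?_
    refine map_mem_of_mem_supported _ ?_ (ih (v ∘ i.succAbove) fun j k => hr _ _)
    rintro τ ⟨hτ, hτr⟩
    rw [TupleChain.cone_single]
    have hmono : (m / (m + 1) * r : ℝ) ≤ ((m + 1 : ℕ) / ((m + 1 : ℕ) + 1) * r : ℝ) := by
      refine mul_le_mul_of_nonneg_right ?_ hr0
      rw [div_le_div_iff₀ (by positivity) (by positivity)]
      push_cast
      nlinarith
    have hτv : ∀ i, (τ i : Fin n → ℝ) ∈ convexHull ℝ (range fun j => (v j : Fin n → ℝ)) :=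
      fun k => convexHull_mono (range_subset_iff.2 fun j => mem_range_self (i.succAbove j)) (hτ k)
    have hbτ : ∀ k, dist (bary m v) (τ k) ≤ m / (m + 1) * r := by
      intro k
      have : convexHull ℝ (range fun j => (v j : Fin n → ℝ)) ⊆
          Metric.closedBall (bary m v : Fin n → ℝ) (m / (m + 1) * r) := by
        refine convexHull_min ?_ (convex_closedBall _ _)
        rintro _ ⟨j, rfl⟩
        rw [Metric.mem_closedBall']
        exact dist_bary_le v hr j
      have h := this (hτv k)
      rwa [Metric.mem_closedBall'] at h
    refine Finsupp.single_mem_supported _ _ ⟨fun j => ?_, fun j k => le_trans ?_ hmono⟩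
    · refine Fin.cases ?_ (fun k => ?_) j
      · exact affineSimp_mem_convexHull v _
      · exact hτv k
    · refine Fin.cases ?_ (fun j => ?_) j <;> refine Fin.cases ?_ (fun k => ?_) k
      · simp only [dist_self]; positivity
      · exact hbτ k
      · rw [dist_comm]; exact hbτ j
      · exact hτr j k

theorem sd_iterate_mem_supported {n m : ℕ} {r : ℝ} (hr0 : 0 ≤ r) {c : TupleChain (Simp n) m}
    (hc : c ∈ Finsupp.supported ℚ ℚ (smallTuples n m r)) (k : ℕ) :
    (TupleChain.sd bary m)^[k] c ∈
      Finsupp.supported ℚ ℚ (smallTuples n m ((m / (m + 1) : ℝ) ^ k * r)) := by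
  induction k with
  | zero => simpa using hc
  | succ k ih =>
    rw [Function.iterate_succ_apply']
    refine map_mem_of_mem_supported _ (fun v hv => ?_) ih
    refine Finsupp.supported_mono ?_ (sd_mem_supported m v (by positivity) hv)
    rintro τ ⟨-, hτ⟩
    rw [pow_succ', mul_assoc]
    exact hτ

namespace SingChain

variable {A : Type*} [TopologicalSpace A]

/-- The chains all of whose simplices lie in `U`. -/
def chainsIn (U : Set A) (m : ℕ) : Submodule ℚ (SingChain A m) :=
  Finsupp.supported ℚ ℚ {σ | ∀ t, σ t ∈ U}

theorem chainsIn_mono {U V : Set A} (h : U ⊆ V) (m : ℕ) : chainsIn U m ≤ chainsIn V m :=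
  Finsupp.supported_mono fun _ hσ t => h (hσ t)

theorem chainsIn_inter (U V : Set A) (m : ℕ) :
    chainsIn (U ∩ V) m = chainsIn U m ⊓ chainsIn V m := by
  rw [chainsIn, chainsIn, chainsIn, ← Finsupp.supported_inter]
  congr 1
  ext σ
  exact forall_and

theorem mem_chainsIn_zero (U : Set A) (c : SingChain A 0) : c ∈ chainsIn U 0 := by
  intro σ _ t
  exact absurd t.2.2 (by simp)

theorem single_mem_chainsIn {U : Set A} {m : ℕ} {σ : C(Simp m, A)} (h : ∀ t, σ t ∈ U) :
    Finsupp.single σ 1 ∈ chainsIn U m :=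
  Finsupp.single_mem_supported _ _ h

theorem push_mem_chainsIn {X : Type*} [TopologicalSpace X] {U : Set A} {f : C(X, A)} {V : Set X}
    (h : ∀ t ∈ V, f t ∈ U) {m : ℕ} {c : SingChain X m} (hc : c ∈ chainsIn V m) :
    push f m c ∈ chainsIn U m := by
  refine map_mem_of_mem_supported _ (fun σ hσ => ?_) hc
  rw [push_single]
  exact single_mem_chainsIn fun t => h _ (hσ t)

theorem mem_chainsIn_univ {m : ℕ} (c : SingChain A m) : c ∈ chainsIn univ m :=
  fun _ _ _ => mem_univ _

theorem push_mem_chainsIn' {X : Type*} [TopologicalSpace X] {U : Set A} {f : C(X, A)}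
    (h : ∀ t, f t ∈ U) {m : ℕ} (c : SingChain X m) : push f m c ∈ chainsIn U m :=
  push_mem_chainsIn (fun t _ => h t) (mem_chainsIn_univ c)

theorem bd_mem_chainsIn {U : Set A} {m : ℕ} {c : SingChain A (m + 1)}
    (hc : c ∈ chainsIn U (m + 1)) : bd m c ∈ chainsIn U m := by
  refine map_mem_of_mem_supported _ (fun σ hσ => ?_) hc
  rw [← push_ofTuple_vertices, ← push_bd]
  exact push_mem_chainsIn' hσ _

theorem sd_mem_chainsIn {U : Set A} {m : ℕ} {c : SingChain A m}
    (hc : c ∈ chainsIn U m) : sd m c ∈ chainsIn U m := by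
  refine map_mem_of_mem_supported _ (fun σ hσ => ?_) hc
  rw [sd_single]
  exact push_mem_chainsIn' hσ _

theorem sdHtpy_mem_chainsIn {U : Set A} {m : ℕ} {c : SingChain A m}
    (hc : c ∈ chainsIn U m) : sdHtpy m c ∈ chainsIn U (m + 1) := by
  refine map_mem_of_mem_supported _ (fun σ hσ => ?_) hc
  rw [sdHtpy_single]
  exact push_mem_chainsIn' hσ _

/-- The chains that are small with respect to two sets `U` and `V`: every simplex lies in one of
the two. -/
def smallChains (U V : Set A) (m : ℕ) : Submodule ℚ (SingChain A m) :=
  chainsIn U m ⊔ chainsIn V m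

theorem map_mem_smallChains {U V : Set A} {m k : ℕ}
    (L : SingChain A m →ₗ[ℚ] SingChain A k)
    (h : ∀ (W : Set A), ∀ c ∈ chainsIn W m, L c ∈ chainsIn W k) {c : SingChain A m}
    (hc : c ∈ smallChains U V m) : L c ∈ smallChains U V k := by
  obtain ⟨a, ha, b, hb, rfl⟩ := Submodule.mem_sup.1 hc
  rw [map_add]
  exact Submodule.add_mem_sup (h U a ha) (h V b hb)

theorem sd_iterate_single {m : ℕ} (σ : C(Simp m, A)) (k : ℕ) :
    (sd m)^[k] (Finsupp.single σ 1) =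
      push σ m (ofTuple m m ((TupleChain.sd bary m)^[k] (vertices m))) := by
  induction k with
  | zero => exact (push_ofTuple_vertices m σ).symm
  | succ k ih =>
    rw [Function.iterate_succ_apply', ih, Function.iterate_succ_apply', ← push_sd, sd_ofTuple]

/-- Lebesgue number argument: iterated subdivision makes a simplex small. -/
theorem eventually_sd_single_mem {U V : Set A} (hU : IsOpen U) (hV : IsOpen V) {m : ℕ}
    {σ : C(Simp m, A)} (hσ : ∀ t, σ t ∈ U ∪ V) :
    ∀ᶠ k in atTop, (sd m)^[k] (Finsupp.single σ 1) ∈ smallChains U V m := by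
  obtain ⟨δ, hδ, hcov⟩ := lebesgue_number_lemma_of_metric (s := (univ : Set (Simp m)))
    (c := fun b : Bool => σ ⁻¹' (cond b U V)) isCompact_univ
    (fun b => (by cases b <;> assumption : IsOpen (cond b U V)).preimage σ.continuous)
    (fun t _ => mem_iUnion.2 <| (hσ t).elim (fun h => ⟨true, h⟩) fun h => ⟨false, h⟩)
  have hlim : Tendsto (fun k : ℕ => ((m / (m + 1) : ℝ) ^ k * 1)) atTop (𝓝 (0 * 1)) := by
    refine Tendsto.mul_const _ (tendsto_pow_atTop_nhds_zero_of_lt_one (by positivity) ?_)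
    rw [div_lt_one (by positivity)]
    linarith
  rw [zero_mul] at hlim
  filter_upwards [hlim.eventually_lt_const hδ] with k hk
  rw [sd_iterate_single]
  have hv : vertices m ∈ Finsupp.supported ℚ ℚ (smallTuples m m 1) := by
    refine Finsupp.single_mem_supported _ _ fun i j => ?_
    rw [Subtype.dist_eq]
    exact (Metric.dist_le_diam_of_mem (bounded_stdSimplex _) (stdSimplex.vertex i).2
      (stdSimplex.vertex j).2).trans diam_stdSimplex_le
  refine map_mem_of_mem_supported (push σ m ∘ₗ ofTuple m m) (fun τ hτ => ?_)
    (sd_iterate_mem_supported zero_le_one hv k)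
  rw [LinearMap.comp_apply, ofTuple_single, push_single]
  cases m with
  | zero => exact Submodule.mem_sup_left (mem_chainsIn_zero _ _)
  | succ m =>
    obtain ⟨b, hb⟩ := hcov (τ 0) (mem_univ _)
    have hball : ∀ t, affineSimp τ t ∈ Metric.ball (τ 0) δ := by
      intro t
      have hsub : convexHull ℝ (range fun j => (τ j : Fin (m + 1) → ℝ)) ⊆
          Metric.ball (τ 0 : Fin (m + 1) → ℝ) δ := by
        refine convexHull_min ?_ (convex_ball _ _)
        rintro _ ⟨j, rfl⟩
        exact (hτ j 0).trans_lt hk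
      exact hsub (affineSimp_mem_convexHull τ t)
    have h : ∀ t, σ.comp (affineSimp τ) t ∈ cond b U V := fun t => hb (hball t)
    cases b
    · exact Submodule.mem_sup_right (single_mem_chainsIn h)
    · exact Submodule.mem_sup_left (single_mem_chainsIn h)

theorem eventually_sd_mem {U V : Set A} (hU : IsOpen U) (hV : IsOpen V) {m : ℕ}
    {c : SingChain A m} (hc : c ∈ chainsIn (U ∪ V) m) :
    ∀ᶠ k in atTop, (sd m)^[k] c ∈ smallChains U V m := by
  rw [chainsIn, Finsupp.supported_eq_span_single] at hc
  induction hc using Submodule.span_induction with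
  | mem x hx =>
    obtain ⟨σ, hσ, rfl⟩ := hx
    exact eventually_sd_single_mem hU hV hσ
  | zero =>
    refine Eventually.of_forall fun k => ?_
    rw [iterate_map_zero]
    exact zero_mem _
  | add x y _ _ hx hy =>
    filter_upwards [hx, hy] with k h1 h2
    rw [iterate_map_add]
    exact add_mem h1 h2
  | smul a x _ hx =>
    filter_upwards [hx] with k h
    have : (sd m)^[k] (a • x) = a • (sd m)^[k] x := by
      rw [← Module.End.coe_pow, map_smul]
    rw [this]
    exact Submodule.smul_mem _ _ h

/-- A chain in `U ∪ V` with small boundary becomes small after the addition of a boundary. -/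
theorem exists_eq_bd_add_small {U V : Set A} (hU : IsOpen U) (hV : IsOpen V) {m : ℕ}
    {z : SingChain A (m + 1)} (hz : z ∈ chainsIn (U ∪ V) (m + 1))
    (hbd : bd m z ∈ smallChains U V m) :
    ∃ w ∈ chainsIn (U ∪ V) (m + 2), ∃ s ∈ smallChains U V (m + 1), z = bd (m + 1) w + s := by
  obtain ⟨k, hk⟩ := (eventually_sd_mem hU hV hz).exists
  induction k generalizing z with
  | zero => exact ⟨0, zero_mem _, z, hk, by simp⟩
  | succ k ih =>
    obtain ⟨w, hw, s, hs, h⟩ := ih (sd_mem_chainsIn hz)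
      (by rw [bd_sd]; exact map_mem_smallChains _ (fun _ _ => sd_mem_chainsIn) hbd) hk
    refine ⟨w + sdHtpy (m + 1) z, add_mem hw (sdHtpy_mem_chainsIn hz), s + sdHtpy m (bd m z),
      add_mem hs (map_mem_smallChains _ (fun _ _ => sdHtpy_mem_chainsIn) hbd), ?_⟩
    rw [map_add, bd_sdHtpy, h]
    abel

end SingChain

end SphereHomology

end

/-! ### The Mayer–Vietoris argument -/

noncomputable section

namespace SphereHomology

open Set Filter Topology

namespace SingChain

section MayerVietoris

variable {A : Type*} [TopologicalSpace A]

/-- Cycles of the augmented singular chain complex. In the lowest degree every chain is one. -/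
def IsCycle : ∀ {m : ℕ}, SingChain A m → Prop
  | 0, _ => True
  | m + 1, c => bd m c = 0

theorem isCycle_bd : ∀ {m : ℕ} (c : SingChain A (m + 1)), IsCycle (bd m c)
  | 0, _ => trivial
  | m + 1, c => bd_bd m c

/-- The reduced homology of the subset `U` vanishes in dimension `m - 1`. -/
def AcyclicAt (U : Set A) (m : ℕ) : Prop :=
  ∀ z ∈ chainsIn U m, IsCycle z → ∃ w ∈ chainsIn U (m + 1), bd m w = z

/-- The reduced homology of the subset `U` is one-dimensional in dimension `m - 1`. -/
def SphericalAt (U : Set A) (m : ℕ) : Prop :=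
  ∃ g ∈ chainsIn U m, IsCycle g ∧ (∀ w ∈ chainsIn U (m + 1), bd m w ≠ g) ∧
    ∀ z ∈ chainsIn U m, IsCycle z → ∃ r : ℚ, ∃ w ∈ chainsIn U (m + 1), z = r • g + bd m w

variable {U V : Set A}

/-- Up to boundaries, a cycle in `U ∪ V` is the sum of a chain in `U` and a chain in `V`, whose
boundary is a cycle in `U ∩ V`. -/
theorem exists_decomposition (hU : IsOpen U) (hV : IsOpen V) {m : ℕ}
    {z : SingChain A (m + 1)} (hz : z ∈ chainsIn (U ∪ V) (m + 1)) (hcyc : bd m z = 0) :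
    ∃ w ∈ chainsIn (U ∪ V) (m + 2), ∃ a ∈ chainsIn U (m + 1), ∃ b ∈ chainsIn V (m + 1),
      z = bd (m + 1) w + a + b ∧ bd m a ∈ chainsIn (U ∩ V) m ∧ bd m b = -bd m a := by
  obtain ⟨w, hw, s, hs, h⟩ := exists_eq_bd_add_small hU hV hz (by rw [hcyc]; exact zero_mem _)
  obtain ⟨a, ha, b, hb, rfl⟩ := Submodule.mem_sup.1 hs
  have hab : bd m b = -bd m a := by
    have := congrArg (bd m) h
    rw [hcyc, map_add, bd_bd, zero_add, map_add] at this
    exact eq_neg_of_add_eq_zero_right this.symm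
  refine ⟨w, hw, a, ha, b, hb, h.trans (add_assoc _ _ _).symm, ?_, hab⟩
  rw [chainsIn_inter]
  refine ⟨bd_mem_chainsIn ha, ?_⟩
  rw [← neg_neg (bd m a), ← hab]
  exact neg_mem (bd_mem_chainsIn hb)

/-- The part of the Mayer–Vietoris sequence that propagates vanishing. -/
theorem AcyclicAt.union (hU : IsOpen U) (hV : IsOpen V) {m : ℕ} (hUa : AcyclicAt U (m + 1))
    (hVa : AcyclicAt V (m + 1)) (h : AcyclicAt (U ∩ V) m) : AcyclicAt (U ∪ V) (m + 1) := by
  intro z hz hcyc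
  obtain ⟨w, hw, a, ha, b, hb, rfl, hab, hba⟩ := exists_decomposition hU hV hz hcyc
  obtain ⟨c, hc, hca⟩ := h _ hab (isCycle_bd a)
  obtain ⟨u, hu, hua⟩ := hUa (a - c) (sub_mem ha (chainsIn_mono inter_subset_left _ hc))
    (by change bd m _ = 0; rw [map_sub, hca, sub_self])
  obtain ⟨v, hv, hvb⟩ := hVa (b + c) (add_mem hb (chainsIn_mono inter_subset_right _ hc))
    (by change bd m _ = 0; rw [map_add, hca, hba, neg_add_cancel])
  refine ⟨w + u + v, add_mem (add_mem hw (chainsIn_mono subset_union_left _ hu))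
    (chainsIn_mono subset_union_right _ hv), ?_⟩
  rw [map_add, map_add, hua, hvb]
  abel

/-- The suspension step: a generating cycle `g` of `U ∩ V` bounds a chain in `U` and one in `V`,
and their difference generates the homology of `U ∪ V`. -/
theorem SphericalAt.union (hU : IsOpen U) (hV : IsOpen V) {m : ℕ}
    (hUa : ∀ k, AcyclicAt U k) (hVa : ∀ k, AcyclicAt V k) (h : SphericalAt (U ∩ V) m) :
    SphericalAt (U ∪ V) (m + 1) := by
  obtain ⟨g, hg, hgc, hgb, hgen⟩ := h
  obtain ⟨a, ha, hag⟩ := hUa m g (chainsIn_mono inter_subset_left _ hg) hgc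
  obtain ⟨b, hb, hbg⟩ := hVa m g (chainsIn_mono inter_subset_right _ hg) hgc
  refine ⟨a - b, sub_mem (chainsIn_mono subset_union_left _ ha)
    (chainsIn_mono subset_union_right _ hb), ?_, ?_, ?_⟩
  · change bd m _ = 0
    rw [map_sub, hag, hbg, sub_self]
  · intro w hw hwab
    obtain ⟨w', -, s, hs, hws⟩ := exists_eq_bd_add_small hU hV hw (by
      rw [hwab]; exact sub_mem (Submodule.mem_sup_left ha) (Submodule.mem_sup_right hb))
    obtain ⟨u, hu, v, hv, rfl⟩ := Submodule.mem_sup.1 hs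
    have huv : a - bd (m + 1) u = b + bd (m + 1) v := by
      rw [hws, map_add, bd_bd, zero_add, map_add] at hwab
      rw [sub_eq_iff_eq_add, add_assoc, add_comm (bd (m + 1) v), hwab]
      abel
    refine hgb (a - bd (m + 1) u) ?_ (by rw [map_sub, bd_bd, sub_zero, hag])
    rw [chainsIn_inter]
    refine ⟨sub_mem ha (bd_mem_chainsIn hu), ?_⟩
    rw [huv]
    exact add_mem hb (bd_mem_chainsIn hv)
  · intro z hz hcyc
    obtain ⟨w, hw, a', ha', b', hb', rfl, hab, hba⟩ := exists_decomposition hU hV hz hcyc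
    obtain ⟨r, c, hc, hrc⟩ := hgen _ hab (isCycle_bd a')
    obtain ⟨u, hu, hua⟩ := hUa (m + 1) (a' - r • a - c)
      (sub_mem (sub_mem ha' (Submodule.smul_mem _ _ ha)) (chainsIn_mono inter_subset_left _ hc))
      (by change bd m _ = 0; rw [map_sub, map_sub, map_smul, hag, hrc]; abel)
    obtain ⟨v, hv, hvb⟩ := hVa (m + 1) (b' + r • b + c)
      (add_mem (add_mem hb' (Submodule.smul_mem _ _ hb)) (chainsIn_mono inter_subset_right _ hc))
      (by change bd m _ = 0; rw [map_add, map_add, map_smul, hbg, hba, hrc]; abel)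
    refine ⟨r, w + u + v, add_mem (add_mem hw (chainsIn_mono subset_union_left _ hu))
      (chainsIn_mono subset_union_right _ hv), ?_⟩
    rw [map_add, map_add, hua, hvb, smul_sub]
    abel

end MayerVietoris

/-! ### Star-shaped sets are acyclic -/

section Cone

variable {A : Type*} [NormedAddCommGroup A]

open Classical in
/-- Extension by zero of a singular simplex to all of `ℝᵐ`, which makes sense of the simplex at
the normalised coordinates of a point even where these do not lie in the standard simplex. -/
def extendSimp {m : ℕ} (σ : C(Simp m, A)) (s : Fin m → ℝ) : A :=
  if h : s ∈ stdSimplex ℝ (Fin m) then σ ⟨s, h⟩ else 0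

theorem extendSimp_coe {m : ℕ} (σ : C(Simp m, A)) (t : Simp m) :
    extendSimp σ (t : Fin m → ℝ) = σ t := dif_pos t.2

theorem extendSimp_of_mem {m : ℕ} (σ : C(Simp m, A)) {s : Fin m → ℝ}
    (h : s ∈ stdSimplex ℝ (Fin m)) : extendSimp σ s = σ ⟨s, h⟩ := dif_pos h

theorem continuousOn_extendSimp {m : ℕ} (σ : C(Simp m, A)) :
    ContinuousOn (extendSimp σ) (stdSimplex ℝ (Fin m)) := by
  rw [continuousOn_iff_continuous_domRestrict]
  convert σ.continuous using 1
  funext t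
  exact extendSimp_coe σ t

theorem exists_norm_extendSimp_le {m : ℕ} (σ : C(Simp m, A)) : ∃ C, ∀ s, ‖extendSimp σ s‖ ≤ C := by
  obtain ⟨C, hC⟩ := (isCompact_range σ.continuous).isBounded.exists_norm_le
  refine ⟨max C 0, fun s => ?_⟩
  rw [extendSimp]
  split_ifs with h
  · exact (hC _ ⟨_, rfl⟩).trans (le_max_left _ _)
  · simp

variable [NormedSpace ℝ A]

theorem simp_tail_sum {m : ℕ} (t : Simp (m + 1)) : ∑ i : Fin m, t i.succ = 1 - t 0 := by
  have := t.2.2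
  rw [Fin.sum_univ_succ] at this
  exact eq_sub_of_add_eq' this

theorem normalize_mem {m : ℕ} {t : Simp (m + 1)} (ht : t 0 ≠ 1) :
    ((1 - t 0)⁻¹ • fun i : Fin m => t i.succ) ∈ stdSimplex ℝ (Fin m) := by
  have h : 0 ≤ 1 - t 0 := by
    rw [← simp_tail_sum]; exact Finset.sum_nonneg fun i _ => t.2.1 _
  refine ⟨fun i => mul_nonneg (inv_nonneg.2 h) (t.2.1 _), ?_⟩
  simp only [Pi.smul_apply, smul_eq_mul, ← Finset.mul_sum]
  rw [simp_tail_sum, inv_mul_cancel₀ (sub_ne_zero.2 ht.symm)]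

theorem continuous_simp_apply {m : ℕ} (i : Fin m) : Continuous fun t : Simp m => t i :=
  (continuous_apply i).comp continuous_subtype_val

/-- The cone over a singular simplex with apex `p`. At the apex itself the second summand is
zero, whatever the value of the extended simplex. -/
def coneSimp (p : A) {m : ℕ} (σ : C(Simp m, A)) : C(Simp (m + 1), A) where
  toFun t := t 0 • p + (1 - t 0) • extendSimp σ ((1 - t 0)⁻¹ • fun i : Fin m => t i.succ)
  continuous_toFun := by
    have hc0 : Continuous fun t : Simp (m + 1) => t 0 := continuous_simp_apply 0
    refine (hc0.smul continuous_const).add (continuous_iff_continuousAt.2 fun t => ?_)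
    by_cases ht : t 0 = 1
    · obtain ⟨C, hC⟩ := exists_norm_extendSimp_le σ
      have hlim : Tendsto (fun s : Simp (m + 1) => |1 - s 0| * C) (𝓝 t) (𝓝 0) := by
        have : Continuous fun s : Simp (m + 1) => |1 - s 0| * C :=
          (continuous_const.sub hc0).abs.mul continuous_const
        simpa [ht] using this.tendsto t
      rw [ContinuousAt, ht, sub_self, zero_smul]
      refine squeeze_zero_norm (fun s => ?_) hlim
      rw [norm_smul, Real.norm_eq_abs]
      exact mul_le_mul_of_nonneg_left (hC _) (abs_nonneg _)
    · have hO : IsOpen {s : Simp (m + 1) | s 0 ≠ 1} := isOpen_ne_fun hc0 continuous_const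
      have hne : ∀ s ∈ {s : Simp (m + 1) | s 0 ≠ 1}, (1 - s 0) ≠ 0 := fun s hs =>
        sub_ne_zero.2 (Ne.symm hs)
      have hc : ContinuousOn (fun s : Simp (m + 1) =>
          (1 - s 0) • extendSimp σ ((1 - s 0)⁻¹ • fun i : Fin m => s i.succ))
          {s | s 0 ≠ 1} := by
        refine (continuous_const.sub hc0).continuousOn.smul ?_
        refine (continuousOn_extendSimp σ).comp ?_ fun s hs => normalize_mem hs
        refine ContinuousOn.smul ((continuous_const.sub hc0).continuousOn.inv₀ hne) ?_
        exact (continuous_pi fun i => continuous_simp_apply _).continuousOn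
      exact hc.continuousAt (hO.mem_nhds ht)

theorem coneSimp_apply (p : A) {m : ℕ} (σ : C(Simp m, A)) (t : Simp (m + 1)) :
    coneSimp p σ t = t 0 • p +
      (1 - t 0) • extendSimp σ ((1 - t 0)⁻¹ • fun i : Fin m => t i.succ) := rfl

theorem face_apply_self {m : ℕ} (i : Fin (m + 1)) (t : Simp m) : face m i t i = 0 := by
  change FunOnFinite.linearMap ℝ ℝ i.succAbove t i = 0
  rw [FunOnFinite.linearMap_apply_apply]
  exact Finset.sum_eq_zero fun k hk =>
    absurd (Finset.mem_filter.1 hk).2 (Fin.succAbove_ne i k)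

theorem face_apply_succAbove {m : ℕ} (i : Fin (m + 1)) (t : Simp m) (k : Fin m) :
    face m i t (i.succAbove k) = t k := by
  change FunOnFinite.linearMap ℝ ℝ i.succAbove t (i.succAbove k) = t k
  rw [FunOnFinite.linearMap_apply_apply, Finset.sum_filter]
  simp

theorem coneSimp_comp_face_zero (p : A) {m : ℕ} (σ : C(Simp m, A)) :
    (coneSimp p σ).comp (face m 0) = σ := by
  ext t
  have h : (fun i : Fin m => face m 0 t i.succ) = (t : Fin m → ℝ) :=
    funext fun k => by rw [← Fin.zero_succAbove, face_apply_succAbove]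
  rw [ContinuousMap.comp_apply, coneSimp_apply, face_apply_self, h]
  simp [extendSimp_coe]

theorem coneSimp_comp_face_succ (p : A) {m : ℕ} (σ : C(Simp (m + 1), A)) (i : Fin (m + 1)) :
    (coneSimp p σ).comp (face (m + 1) i.succ) = coneSimp p (σ.comp (face m i)) := by
  ext t
  have h0 : face (m + 1) i.succ t 0 = t 0 := by
    rw [← Fin.succ_succAbove_zero i, face_apply_succAbove]
  rw [ContinuousMap.comp_apply, coneSimp_apply, coneSimp_apply, h0]
  by_cases ht : t 0 = 1
  · simp [ht]
  · congr 2
    have hmem := normalize_mem ht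
    rw [extendSimp_of_mem _ hmem, ContinuousMap.comp_apply, ← extendSimp_coe σ]
    congr 1
    funext k
    refine Fin.succAboveCases i ?_ (fun l => ?_) k
    · rw [face_apply_self, Pi.smul_apply, face_apply_self, smul_zero]
    · rw [face_apply_succAbove, Pi.smul_apply, ← Fin.succ_succAbove_succ, face_apply_succAbove]
      rfl

/-- The cone operator on singular chains of a vector space. -/
def coneChain (p : A) (m : ℕ) : SingChain A m →ₗ[ℚ] SingChain A (m + 1) :=
  Finsupp.lmapDomain ℚ ℚ (coneSimp p)

theorem coneChain_single (p : A) {m : ℕ} (σ : C(Simp m, A)) :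
    coneChain p m (Finsupp.single σ 1) = Finsupp.single (coneSimp p σ) 1 := by
  simp [coneChain]

theorem bd_coneChain (p : A) : ∀ {m : ℕ} {c : SingChain A m}, IsCycle c →
    bd m (coneChain p m c) = c
  | 0, c, _ => by
    suffices h : bd 0 ∘ₗ coneChain p 0 = LinearMap.id from LinearMap.congr_fun h c
    refine Finsupp.lhom_ext' fun v => LinearMap.ext_ring ?_
    simp only [LinearMap.comp_apply, Finsupp.lsingle_apply, coneChain_single, bd_single]
    rw [Fin.sum_univ_succ, coneSimp_comp_face_zero]
    simp
  | m + 1, c, hc => by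
    suffices h : bd (m + 1) ∘ₗ coneChain p (m + 1) = LinearMap.id - coneChain p m ∘ₗ bd m by
      have h' := LinearMap.congr_fun h c
      simp only [LinearMap.comp_apply, LinearMap.sub_apply, LinearMap.id_apply] at h'
      rw [h', show bd m c = 0 from hc, map_zero, sub_zero]
    refine Finsupp.lhom_ext' fun v => LinearMap.ext_ring ?_
    simp only [LinearMap.comp_apply, Finsupp.lsingle_apply, coneChain_single, bd_single,
      LinearMap.sub_apply, LinearMap.id_apply, map_sum, map_smul]
    rw [Fin.sum_univ_succ, sub_eq_add_neg, ← Finset.sum_neg_distrib]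
    simp only [coneSimp_comp_face_zero, coneSimp_comp_face_succ, Fin.val_zero, pow_zero, one_smul,
      Fin.val_succ, pow_succ, mul_neg_one, neg_smul]

theorem coneChain_mem_chainsIn {p : A} {U : Set A} (hU : StarConvex ℝ p U) (hp : p ∈ U) {m : ℕ}
    {c : SingChain A m} (hc : c ∈ chainsIn U m) : coneChain p m c ∈ chainsIn U (m + 1) := by
  refine map_mem_of_mem_supported _ (fun σ hσ => ?_) hc
  rw [coneChain_single]
  refine single_mem_chainsIn fun t => ?_
  rw [coneSimp_apply]
  by_cases ht : t 0 = 1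
  · simpa [ht] using hp
  · rw [extendSimp_of_mem _ (normalize_mem ht)]
    have h : 0 ≤ 1 - t 0 := by
      rw [← simp_tail_sum]; exact Finset.sum_nonneg fun i _ => t.2.1 _
    exact hU (hσ _) (t.2.1 0) h (by ring)

theorem acyclicAt_of_starConvex {p : A} {U : Set A} (hU : StarConvex ℝ p U) (hp : p ∈ U) (m : ℕ) :
    AcyclicAt U m :=
  fun z hz hcyc => ⟨coneChain p m z, coneChain_mem_chainsIn hU hp hz, bd_coneChain p hcyc⟩

end Cone

/-! ### The homology of punctured Euclidean space -/

section Punctured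

variable {N : ℕ}

/-- The complement in `ℝᴺ` of the subspace where the first `j` coordinates vanish. -/
def punctured (N j : ℕ) : Set (EuclideanSpace ℝ (Fin N)) :=
  {x | ∃ i : Fin N, (i : ℕ) < j ∧ x i ≠ 0}

/-- Adjoining to the punctured space an open half-space of the next coordinate makes it star-shaped
about a point on that coordinate axis. -/
theorem starConvex_punctured_union_halfSpace (j : Fin N) (s : ℝ) (hs : s ≠ 0) :
    StarConvex ℝ (EuclideanSpace.single j s)
      (punctured N j ∪ {x : EuclideanSpace ℝ (Fin N) | 0 < s * x j}) := by
  intro x hx a b ha hb hab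
  rcases hx with ⟨i, hij, hi⟩ | hx
  · rcases hb.eq_or_lt with rfl | hb
    · right
      have : a = 1 := by linarith
      simpa [this] using hs
    · left
      refine ⟨i, hij, ?_⟩
      have hne : i ≠ j := fun h => by simp [h] at hij
      simp [hne, hb.ne', hi]
  · right
    have hx' : 0 < s * x j := hx
    have h : s * (a * s + b * x j) = a * (s * s) + b * (s * x j) := by ring
    have hss : 0 < s * s := mul_self_pos.2 hs
    have : 0 < a * (s * s) + b * (s * x j) := by
      rcases ha.eq_or_lt with rfl | ha
      · have : b = 1 := by linarith
        simpa [this] using hx'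
      · have := mul_pos ha hss
        have := mul_nonneg hb hx'.le
        linarith
    simpa [h] using this

theorem isOpen_punctured (j : ℕ) : IsOpen (punctured N j) := by
  have : punctured N j = ⋃ i : Fin N, {x : EuclideanSpace ℝ (Fin N) | (i : ℕ) < j ∧ x i ≠ 0} := by
    ext x; simp [punctured]
  rw [this]
  refine isOpen_iUnion fun i => IsOpen.and isOpen_const ?_
  exact isOpen_ne_fun (by fun_prop) continuous_const

/-- Passing from `j` to `j + 1` coordinates is a suspension: the larger set is the union of two
star-shaped open sets whose intersection is the smaller one. -/
theorem punctured_homology {j : ℕ} (hj : j ≤ N) :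
    SphericalAt (punctured N j) j ∧ ∀ m, m ≠ j → AcyclicAt (punctured N j) m := by
  induction j with
  | zero =>
    -- only the empty simplex lies in the empty set, and it is a cycle that bounds nothing
    have he : punctured N 0 = ∅ := by ext x; simp [punctured]
    have hbot : ∀ m, ∀ c ∈ chainsIn (punctured N 0) (m + 1), c = 0 := by
      intro m c hc
      rw [he] at hc
      have : {σ : C(Simp (m + 1), EuclideanSpace ℝ (Fin N)) | ∀ t, σ t ∈ (∅ : Set _)} = ∅ := by
        ext σ
        simp
      rw [chainsIn, this, Finsupp.supported_empty] at hc
      exact hc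
    have hemp : IsEmpty (Simp 0) := ⟨fun t => absurd t.2.2 (by simp)⟩
    set e : C(Simp 0, EuclideanSpace ℝ (Fin N)) := ContinuousMap.const _ 0
    have huniq : ∀ σ : C(Simp 0, EuclideanSpace ℝ (Fin N)), σ = e :=
      fun σ => ContinuousMap.ext fun t => hemp.elim t
    refine ⟨⟨Finsupp.single e 1, mem_chainsIn_zero _ _, trivial, fun w hw => ?_,
      fun z _ _ => ⟨z e, 0, zero_mem _, ?_⟩⟩, fun m hm => ?_⟩
    · rw [hbot 0 w hw, map_zero]
      exact (Finsupp.single_ne_zero.2 one_ne_zero).symm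
    · rw [map_zero, add_zero, Finsupp.smul_single, smul_eq_mul, mul_one]
      ext σ
      rw [huniq σ, Finsupp.single_eq_same]
    · obtain ⟨m, rfl⟩ := Nat.exists_eq_succ_of_ne_zero hm
      intro z hz _
      exact ⟨0, zero_mem _, by rw [map_zero, hbot m z hz]⟩
  | succ j ih =>
    obtain ⟨ihs, iha⟩ := ih (by omega)
    set J : Fin N := ⟨j, hj⟩ with hJ
    set U : Set (EuclideanSpace ℝ (Fin N)) := punctured N j ∪ {x | 0 < (1 : ℝ) * x J} with hUdef
    set V : Set (EuclideanSpace ℝ (Fin N)) := punctured N j ∪ {x | 0 < (-1 : ℝ) * x J} with hVdef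
    have hU : IsOpen U := (isOpen_punctured j).union
      (isOpen_lt continuous_const (by fun_prop))
    have hV : IsOpen V := (isOpen_punctured j).union
      (isOpen_lt continuous_const (by fun_prop))
    have hUa : ∀ k, AcyclicAt U k := acyclicAt_of_starConvex
      (starConvex_punctured_union_halfSpace J 1 one_ne_zero)
      (Or.inr (by simp))
    have hVa : ∀ k, AcyclicAt V k := acyclicAt_of_starConvex
      (starConvex_punctured_union_halfSpace J (-1) (by norm_num)) (Or.inr (by simp))
    have hinter : U ∩ V = punctured N j := by
      rw [hUdef, hVdef, ← union_inter_distrib_left]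
      refine union_eq_left.2 ?_
      rintro x ⟨h1, h2⟩
      simp only [mem_ofPred_eq] at h1 h2
      linarith
    have hunion : U ∪ V = punctured N (j + 1) := by
      ext x
      constructor
      · rintro ((⟨i, hi, hx⟩ | h) | (⟨i, hi, hx⟩ | h))
        · exact ⟨i, by omega, hx⟩
        · exact ⟨J, by simp [hJ], fun h0 => by simp [h0] at h⟩
        · exact ⟨i, by omega, hx⟩
        · exact ⟨J, by simp [hJ], fun h0 => by simp [h0] at h⟩
      · rintro ⟨i, hi, hx⟩
        rcases Nat.lt_succ_iff_lt_or_eq.1 hi with h | h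
        · exact Or.inl (Or.inl ⟨i, h, hx⟩)
        · obtain rfl : i = J := Fin.ext h
          rcases lt_or_gt_of_ne hx with h | h
          · exact Or.inr (Or.inr (by simpa using h))
          · exact Or.inl (Or.inr (by simpa using h))
    rw [← hunion]
    refine ⟨SphericalAt.union hU hV hUa hVa (hinter ▸ ihs), fun m hm => ?_⟩
    cases m with
    | zero =>
      intro z _ hz
      obtain ⟨w, hw, h⟩ := hUa 0 z (mem_chainsIn_zero _ _) hz
      exact ⟨w, chainsIn_mono subset_union_left _ hw, h⟩
    | succ m =>
      exact AcyclicAt.union hU hV (hUa _) (hVa _) (hinter ▸ iha m (by omega))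

end Punctured

end SingChain

end SphereHomology

end

/-! ### Comparison with singular homology in Mathlib -/

noncomputable section

namespace SphereHomology

open Set

namespace SingChain

section Subtype

variable {A : Type*} [TopologicalSpace A] (U : Set A)

/-- The inclusion of a subset as a continuous map. -/
def incl : C(U, A) := ⟨Subtype.val, continuous_subtype_val⟩

theorem push_incl_injective (m : ℕ) : Function.Injective (push (incl U) m) := by
  refine Finsupp.mapDomain_injective fun σ τ h => ?_
  ext t
  exact congrArg (fun ρ : C(Simp m, A) => ρ t) h

variable {U}

theorem exists_push_incl_eq {m : ℕ} {c : SingChain A m} (hc : c ∈ chainsIn U m) :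
    ∃ c', push (incl U) m c' = c := by
  suffices h : c ∈ LinearMap.range (push (incl U) m) from h
  refine map_mem_of_mem_supported LinearMap.id (fun σ hσ => ?_) hc
  refine ⟨Finsupp.single ⟨fun t => ⟨σ t, hσ t⟩, σ.continuous.subtype_mk _⟩ 1, ?_⟩
  rw [push_single]
  rfl

theorem isCycle_push {X : Type*} [TopologicalSpace X] (f : C(X, A)) :
    ∀ {m : ℕ} {c : SingChain X m}, IsCycle c → IsCycle (push f m c)
  | 0, _, _ => trivial
  | m + 1, c, h => by
    change bd m _ = 0
    rw [← push_bd, show bd m c = 0 from h, map_zero]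

theorem isCycle_of_push_incl :
    ∀ {m : ℕ} {c : SingChain U m}, IsCycle (push (incl U) m c) → IsCycle c
  | 0, _, _ => trivial
  | m + 1, c, h => push_incl_injective U m <| by
    rw [push_bd, map_zero]; exact h

theorem push_incl_mem_chainsIn {m : ℕ} (c : SingChain U m) : push (incl U) m c ∈ chainsIn U m :=
  push_mem_chainsIn' (fun t => t.2) c

theorem AcyclicAt.subtype {m : ℕ} (h : AcyclicAt U m) : AcyclicAt (univ : Set U) m := by
  intro z _ hz
  obtain ⟨w, hw, hwz⟩ := h _ (push_incl_mem_chainsIn z) (isCycle_push _ hz)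
  obtain ⟨w, rfl⟩ := exists_push_incl_eq hw
  exact ⟨w, mem_chainsIn_univ _, push_incl_injective U m (by rw [push_bd, hwz])⟩

theorem SphericalAt.subtype {m : ℕ} (h : SphericalAt U m) : SphericalAt (univ : Set U) m := by
  obtain ⟨g, hg, hgc, hgb, hgen⟩ := h
  obtain ⟨g, rfl⟩ := exists_push_incl_eq hg
  refine ⟨g, mem_chainsIn_univ _, isCycle_of_push_incl hgc, fun w _ hw => ?_, fun z _ hz => ?_⟩
  · exact hgb _ (push_incl_mem_chainsIn w) (by rw [← push_bd, hw])
  · obtain ⟨r, w, hw, h⟩ := hgen _ (push_incl_mem_chainsIn z) (isCycle_push _ hz)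
    obtain ⟨w, rfl⟩ := exists_push_incl_eq hw
    refine ⟨r, w, mem_chainsIn_univ _, push_incl_injective U m ?_⟩
    rw [h, map_add, map_smul, push_bd]

end Subtype

section Comparison

open CategoryTheory CategoryTheory.Limits Simplicial

variable (X : Type) [TopologicalSpace X]

/-- The singular chain complex of `X` with rational coefficients. -/
abbrev singComplex : ChainComplex (ModuleCat.{0} ℚ) ℕ :=
  (TopCat.toSSet.obj (TopCat.of X)).chainComplex (ModuleCat.of ℚ ℚ)

/-- The singular simplices of `X` as continuous maps. -/
def simplexEquiv (n : ℕ) : (TopCat.toSSet.obj (TopCat.of X)) _⦋n⦌ ≃ C(Simp (n + 1), X) :=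
  TopCat.toSSetObjEquiv (TopCat.of X) (.op ⦋n⦌)

theorem simplexEquiv_δ (n : ℕ) (i : Fin (n + 2))
    (x : (TopCat.toSSet.obj (TopCat.of X)) _⦋n + 1⦌) :
    simplexEquiv X n ((TopCat.toSSet.obj (TopCat.of X)).δ i x) =
      (simplexEquiv X (n + 1) x).comp (face (n + 1) i) := rfl

/-- The canonical map from Mathlib's singular chains to formal combinations of simplices. -/
def toSing (n : ℕ) : (singComplex X).X n ⟶ ModuleCat.of ℚ (SingChain X (n + 1)) :=
  Sigma.desc fun x => ModuleCat.ofHom (Finsupp.lsingle (simplexEquiv X n x))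

theorem ι_toSing (n : ℕ) (x : (TopCat.toSSet.obj (TopCat.of X)) _⦋n⦌) :
    (TopCat.toSSet.obj (TopCat.of X)).ιChainComplex x ≫ toSing X n =
      ModuleCat.ofHom (Finsupp.lsingle (simplexEquiv X n x)) :=
  Sigma.ι_desc _ _

/-- The inverse of `toSing`. -/
def ofSing (n : ℕ) : ModuleCat.of ℚ (SingChain X (n + 1)) ⟶ (singComplex X).X n :=
  ModuleCat.ofHom <| Finsupp.linearCombination ℚ fun σ =>
    ((TopCat.toSSet.obj (TopCat.of X)).ιChainComplex (R := ModuleCat.of ℚ ℚ)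
      ((simplexEquiv X n).symm σ)).hom (1 : ℚ)

theorem toSing_ofSing (n : ℕ) : toSing X n ≫ ofSing X n = 𝟙 _ := by
  refine SSet.chainComplex_hom_ext fun x => ?_
  rw [← Category.assoc, ι_toSing]
  refine ModuleCat.hom_ext (LinearMap.ext_ring ?_)
  refine (Finsupp.linearCombination_single ℚ (1 : ℚ) (simplexEquiv X n x)).trans
    ((one_smul ℚ _).trans ?_)
  rw [Equiv.symm_apply_apply, Category.comp_id]

theorem ofSing_toSing (n : ℕ) : ofSing X n ≫ toSing X n = 𝟙 _ := by
  refine ModuleCat.hom_ext (Finsupp.lhom_ext' fun σ => LinearMap.ext_ring ?_)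
  have h := congrArg (fun f => f.hom (1 : ℚ)) (ι_toSing X n ((simplexEquiv X n).symm σ))
  rw [Equiv.apply_symm_apply] at h
  change (toSing X n).hom (Finsupp.linearCombination ℚ _ (Finsupp.single σ (1 : ℚ))) = _
  rw [Finsupp.linearCombination_single, one_smul]
  exact h

/-- Mathlib's singular chains are the formal combinations of singular simplices. -/
def singIso (n : ℕ) : (singComplex X).X n ≃ₗ[ℚ] SingChain X (n + 1) :=
  Iso.toLinearEquiv ⟨toSing X n, ofSing X n, toSing_ofSing X n, ofSing_toSing X n⟩

theorem singIso_d (n : ℕ) (c : (singComplex X).X (n + 1)) :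
    singIso X n (((singComplex X).d (n + 1) n).hom c) = bd (n + 1) (singIso X (n + 1) c) := by
  suffices h : (singComplex X).d (n + 1) n ≫ toSing X n =
      toSing X (n + 1) ≫ ModuleCat.ofHom (bd (n + 1)) from
    congrArg (fun f => f.hom c) h
  refine SSet.chainComplex_hom_ext fun x => ?_
  rw [← Category.assoc, ← Category.assoc, SSet.ιChainComplex_d, ι_toSing, Preadditive.sum_comp]
  refine ModuleCat.hom_ext (LinearMap.ext_ring ?_)
  rw [ModuleCat.hom_comp, LinearMap.comp_apply]
  erw [bd_single]
  rw [ModuleCat.hom_sum, LinearMap.sum_apply]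
  refine Finset.sum_congr rfl fun i _ => ?_
  rw [Preadditive.zsmul_comp, ι_toSing, simplexEquiv_δ]
  simp

theorem rank_homology_eq_zero (S : ShortComplex (ModuleCat.{0} ℚ))
    (h : ∀ x, S.g.hom x = 0 → ∃ y, S.f.hom y = x) : Module.rank ℚ S.homology = 0 := by
  have hE : S.Exact := S.moduleCat_exact_iff.2 h
  have := ModuleCat.subsingleton_of_isZero ((S.exact_iff_isZero_homology).1 hE)
  exact rank_subsingleton' _ _

theorem rank_homology_eq_one (S : ShortComplex (ModuleCat.{0} ℚ)) (g : S.X₂)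
    (hg : S.g.hom g = 0) (hgb : ∀ y, S.f.hom y ≠ g)
    (h : ∀ x, S.g.hom x = 0 → ∃ r : ℚ, ∃ y, x = r • g + S.f.hom y) :
    Module.rank ℚ S.homology = 1 := by
  rw [S.moduleCatHomologyIso.toLinearEquiv.rank_eq]
  change Module.rank ℚ (LinearMap.ker S.g.hom ⧸ LinearMap.range S.moduleCatToCycles) = 1
  rw [Module.rank_eq_one_iff_finrank_eq_one]
  refine finrank_eq_one (Submodule.Quotient.mk ⟨g, hg⟩) (fun h0 => ?_) fun w => ?_
  · obtain ⟨y, hy⟩ := (Submodule.Quotient.mk_eq_zero _).1 h0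
    exact hgb y (congrArg Subtype.val hy)
  · obtain ⟨⟨x, hx⟩, rfl⟩ := Submodule.Quotient.mk_surjective _ w
    obtain ⟨r, y, hxy⟩ := h x hx
    refine ⟨r, ?_⟩
    rw [← Submodule.Quotient.mk_smul, eq_comm, Submodule.Quotient.eq]
    refine ⟨y, Subtype.ext ?_⟩
    change S.f.hom y = x - r • g
    rw [hxy, add_sub_cancel_left]

theorem rank_homology_succ_eq_zero (K : ChainComplex (ModuleCat.{0} ℚ) ℕ) (n : ℕ)
    (h : ∀ x : K.X (n + 1), (K.d (n + 1) n).hom x = 0 →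
      ∃ y : K.X (n + 2), (K.d (n + 2) (n + 1)).hom y = x) :
    Module.rank ℚ (K.homology (n + 1)) = 0 :=
  ((ShortComplex.homologyMapIso (K.isoSc' (n + 2) (n + 1) n (by simp)
    (by simp))).toLinearEquiv.rank_eq).trans (rank_homology_eq_zero _ h)

theorem rank_homology_succ_eq_one (K : ChainComplex (ModuleCat.{0} ℚ) ℕ) (n : ℕ)
    (g : K.X (n + 1)) (hg : (K.d (n + 1) n).hom g = 0)
    (hgb : ∀ y : K.X (n + 2), (K.d (n + 2) (n + 1)).hom y ≠ g)
    (h : ∀ x : K.X (n + 1), (K.d (n + 1) n).hom x = 0 →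
      ∃ r : ℚ, ∃ y : K.X (n + 2), x = r • g + (K.d (n + 2) (n + 1)).hom y) :
    Module.rank ℚ (K.homology (n + 1)) = 1 :=
  ((ShortComplex.homologyMapIso (K.isoSc' (n + 2) (n + 1) n (by simp)
    (by simp))).toLinearEquiv.rank_eq).trans (rank_homology_eq_one _ g hg hgb h)

theorem bettiNumber_succ_eq_zero {n : ℕ} (h : AcyclicAt (univ : Set X) (n + 2)) :
    RobotArm.bettiNumber X (n + 1) = 0 := by
  refine rank_homology_succ_eq_zero (singComplex X) n fun x hx => ?_
  obtain ⟨w, -, hw⟩ := h (singIso X (n + 1) x) (mem_chainsIn_univ _) (by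
    change bd (n + 1) _ = 0
    rw [← singIso_d, hx, map_zero])
  refine ⟨(singIso X (n + 2)).symm w, (singIso X (n + 1)).injective ?_⟩
  rw [singIso_d, LinearEquiv.apply_symm_apply, hw]

theorem bettiNumber_succ_eq_one {n : ℕ} (h : SphericalAt (univ : Set X) (n + 2)) :
    RobotArm.bettiNumber X (n + 1) = 1 := by
  obtain ⟨g, -, hg, hgb, hgen⟩ := h
  refine rank_homology_succ_eq_one (singComplex X) n ((singIso X (n + 1)).symm g)
    ((singIso X n).injective ?_) (fun y hy => ?_) fun x hx => ?_
  · rw [singIso_d, LinearEquiv.apply_symm_apply, map_zero]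
    exact hg
  · refine hgb (singIso X (n + 2) y) (mem_chainsIn_univ _) ?_
    rw [← singIso_d, hy, LinearEquiv.apply_symm_apply]
  · obtain ⟨r, w, -, hw⟩ := hgen (singIso X (n + 1) x) (mem_chainsIn_univ _) (by
      change bd (n + 1) _ = 0
      rw [← singIso_d, hx, map_zero])
    refine ⟨r, (singIso X (n + 2)).symm w, (singIso X (n + 1)).injective ?_⟩
    rw [hw, map_add, map_smul, singIso_d, LinearEquiv.apply_symm_apply,
      LinearEquiv.apply_symm_apply]

theorem bettiNumber_zero_eq_one [PathConnectedSpace X] : RobotArm.bettiNumber X 0 = 1 := by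
  have : PathConnectedSpace (TopCat.of X) := ‹_›
  have h := (asIso ((TopCat.of X).singularHomology₀ε (ModuleCat.of ℚ ℚ))).toLinearEquiv.rank_eq
  exact h.trans (Module.rank_self ℚ)

theorem bettiNumber_congr {X Y : Type} [TopologicalSpace X] [TopologicalSpace Y]
    (e : ContinuousMap.HomotopyEquiv X Y) (k : ℕ) :
    RobotArm.bettiNumber X k = RobotArm.bettiNumber Y k := by
  let F := (AlgebraicTopology.singularHomologyFunctor (ModuleCat.{0} ℚ) k).obj (ModuleCat.of ℚ ℚ)
  let f : TopCat.of X ⟶ TopCat.of Y := TopCat.ofHom e.toFun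
  let g : TopCat.of Y ⟶ TopCat.of X := TopCat.ofHom e.invFun
  have hfg : F.map (f ≫ g) = F.map (𝟙 _) :=
    TopCat.Homotopy.congr_homologyMap_singularChainComplexFunctor
      (f := f ≫ g) (g := 𝟙 _) e.left_inv.some _ _
  have hgf : F.map (g ≫ f) = F.map (𝟙 _) :=
    TopCat.Homotopy.congr_homologyMap_singularChainComplexFunctor
      (f := g ≫ f) (g := 𝟙 _) e.right_inv.some _ _
  exact (Iso.toLinearEquiv (⟨F.map f, F.map g, by rw [← F.map_comp, hfg, F.map_id],
    by rw [← F.map_comp, hgf, F.map_id]⟩ : F.obj (TopCat.of X) ≅ F.obj (TopCat.of Y))).rank_eq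

end Comparison

end SingChain

/-! ### Betti numbers of spheres -/

/-- The unit sphere is a deformation retract of the punctured space, the latter being described by
the non-vanishing of some coordinate. -/
def sphereHomotopyEquiv (N : ℕ) :
    ContinuousMap.HomotopyEquiv (Metric.sphere (0 : EuclideanSpace ℝ (Fin N)) 1)
      (SingChain.punctured N N) where
  toFun := ⟨fun x => ⟨x, by
    have hx : (x : EuclideanSpace ℝ (Fin N)) ≠ 0 := ne_zero_of_mem_unit_sphere x
    by_contra h
    refine hx (PiLp.ext fun i => ?_)
    by_contra hi
    exact h ⟨i, i.2, hi⟩⟩, by fun_prop⟩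
  invFun := ⟨fun x => ⟨‖(x : EuclideanSpace ℝ (Fin N))‖⁻¹ • (x : EuclideanSpace ℝ (Fin N)), by
    have hx : (x : EuclideanSpace ℝ (Fin N)) ≠ 0 := by
      obtain ⟨i, -, hi⟩ := x.2
      exact fun h => hi (by rw [h]; rfl)
    rw [mem_sphere_zero_iff_norm, norm_smul, norm_inv, norm_norm,
      inv_mul_cancel₀ (norm_ne_zero_iff.2 hx)]⟩, by
    refine Continuous.subtype_mk ((continuous_subtype_val.norm.inv₀ fun x => ?_).smul
      continuous_subtype_val) _
    obtain ⟨i, -, hi⟩ := x.2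
    exact norm_ne_zero_iff.2 fun h => hi (by rw [h]; rfl)⟩
  left_inv := by
    convert ContinuousMap.Homotopic.refl _
    ext x : 2
    simp
  right_inv := by
    -- the straight line from `x / ‖x‖` to `x` consists of positive multiples of `x`
    have hpos : ∀ (t : unitInterval) (x : SingChain.punctured N N),
        0 < (1 - (t : ℝ)) * ‖(x : EuclideanSpace ℝ (Fin N))‖⁻¹ + t := by
      intro t x
      have hx : 0 < ‖(x : EuclideanSpace ℝ (Fin N))‖⁻¹ := by
        obtain ⟨i, -, hi⟩ := x.2
        exact inv_pos.2 (norm_pos_iff.2 fun h => hi (by rw [h]; rfl))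
      rcases t.2.1.eq_or_lt with h | h
      · rw [← h]; simpa using hx
      · have := mul_nonneg (sub_nonneg.2 t.2.2) hx.le
        linarith
    refine ⟨⟨⟨fun p => ⟨((1 - (p.1 : ℝ)) * ‖(p.2 : EuclideanSpace ℝ (Fin N))‖⁻¹ + p.1) •
      (p.2 : EuclideanSpace ℝ (Fin N)), ?_⟩, ?_⟩, ?_, ?_⟩⟩
    · obtain ⟨i, hi, hx⟩ := p.2.2
      exact ⟨i, hi, mul_ne_zero (hpos p.1 p.2).ne' hx⟩
    · have h1 : Continuous fun p : unitInterval × SingChain.punctured N N => (p.1 : ℝ) :=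
        continuous_subtype_val.comp continuous_fst
      have h2 : Continuous fun p : unitInterval × SingChain.punctured N N =>
          (p.2 : EuclideanSpace ℝ (Fin N)) := continuous_subtype_val.comp continuous_snd
      refine Continuous.subtype_mk ((((continuous_const.sub h1).mul
        (h2.norm.inv₀ fun p => ?_)).add h1).smul h2) _
      obtain ⟨i, -, hi⟩ := p.2.2
      exact norm_ne_zero_iff.2 fun h => hi (by rw [h]; rfl)
    · intro x
      ext : 1
      simp
    · intro x
      ext : 1
      simp

/-- The Betti numbers of the three-dimensional sphere. -/
theorem bettiNumber_of_homeomorph_sphere {X : Type} [TopologicalSpace X]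
    (e : X ≃ₜ Metric.sphere (0 : EuclideanSpace ℝ (Fin 4)) 1) (k : ℕ) :
    RobotArm.bettiNumber X k = if k = 0 ∨ k = 3 then 1 else 0 := by
  rw [SingChain.bettiNumber_congr e.toHomotopyEquiv]
  cases k with
  | zero =>
    have : PathConnectedSpace (Metric.sphere (0 : EuclideanSpace ℝ (Fin 4)) 1) :=
      isPathConnected_iff_pathConnectedSpace.1 <| isPathConnected_sphere
        (by rw [← Module.finrank_eq_rank]; simp) _ zero_le_one
    rw [if_pos (Or.inl rfl)]
    exact SingChain.bettiNumber_zero_eq_one _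
  | succ n =>
    rw [SingChain.bettiNumber_congr (sphereHomotopyEquiv 4)]
    obtain ⟨hs, ha⟩ := SingChain.punctured_homology (N := 4) le_rfl
    by_cases hn : n = 2
    · subst hn
      rw [if_pos (Or.inr rfl)]
      exact SingChain.bettiNumber_succ_eq_one _ hs.subtype
    · rw [if_neg (by omega)]
      exact SingChain.bettiNumber_succ_eq_zero _ (ha (n + 2) (by omega)).subtype

end SphereHomology

end

/-! ### Extrema and topological Morse charts -/

noncomputable section

namespace RobotArm

open Set Filter Topology

section Extrema

variable {M : Type} [TopologicalSpace M] {n : ℕ} {f : M → ℝ} {p : M}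

/-- In a chart centred at `p`, both directions of every coordinate axis are realised near `p`. -/
theorem exists_chart_axis (φ : OpenPartialHomeomorph M (E n)) (hp : p ∈ φ.source) (h0 : φ p = 0)
    (i : Fin n) : ∃ ε : ℝ, 0 < ε ∧ (∃ x ∈ φ.source, φ x = EuclideanSpace.single i ε) ∧
      ∃ x ∈ φ.source, φ x = EuclideanSpace.single i (-ε) := by
  have hT : φ.target ∈ 𝓝 (0 : E n) := φ.open_target.mem_nhds (h0 ▸ φ.map_source hp)
  have hc : Continuous fun t : ℝ => (EuclideanSpace.single i t : E n) := by
    have : (fun t : ℝ => (EuclideanSpace.single i t : E n)) =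
        fun t => t • EuclideanSpace.single i 1 := by
      funext t
      ext j
      by_cases h : j = i <;> simp [h]
    rw [this]
    fun_prop
  have h1 : ∀ᶠ t in 𝓝 (0 : ℝ), (EuclideanSpace.single i t : E n) ∈ φ.target :=
    hc.continuousAt.eventually_mem (by
      have h : (EuclideanSpace.single i 0 : E n) = 0 := by
        ext j
        by_cases h : j = i <;> simp [h]
      rwa [h])
  obtain ⟨δ, hδ, hball⟩ := Metric.eventually_nhds_iff.1 h1
  refine ⟨δ / 2, by positivity, ⟨φ.symm (EuclideanSpace.single i (δ / 2)), ?_, ?_⟩,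
    ⟨φ.symm (EuclideanSpace.single i (-(δ / 2))), ?_, ?_⟩⟩
  · exact φ.map_target (hball (by simp [abs_of_pos hδ]; linarith))
  · exact φ.right_inv (hball (by simp [abs_of_pos hδ]; linarith))
  · exact φ.map_target (hball (by simp [abs_of_pos hδ]; linarith))
  · exact φ.right_inv (hball (by simp [abs_of_pos hδ]; linarith))

theorem isTopCriticalPoint_of_isMax (h : ∀ x, f x ≤ f p) : IsTopCriticalPoint n f p := by
  rintro ⟨φ, i, hp, h0, hf⟩
  obtain ⟨ε, hε, ⟨x, hx, hxi⟩, -⟩ := exists_chart_axis φ hp h0 i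
  have := hf x hx
  rw [hxi] at this
  have := h x
  simp at *
  linarith

theorem isTopCriticalPoint_of_isMin (h : ∀ x, f p ≤ f x) : IsTopCriticalPoint n f p := by
  rintro ⟨φ, i, hp, h0, hf⟩
  obtain ⟨ε, hε, -, ⟨x, hx, hxi⟩⟩ := exists_chart_axis φ hp h0 i
  have := hf x hx
  rw [hxi] at this
  have := h x
  simp at *
  linarith

/-- The quadratic normal form of index `k` on a coordinate axis. -/
theorem sum_quadratic_single (k : ℕ) (i : Fin n) (ε : ℝ) :
    (∑ j : Fin n, if (j : ℕ) < k then -((EuclideanSpace.single i ε : E n) j) ^ 2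
      else ((EuclideanSpace.single i ε : E n) j) ^ 2) =
      if (i : ℕ) < k then -ε ^ 2 else ε ^ 2 := by
  rw [Finset.sum_eq_single i]
  · simp
  · intro j _ hj
    simp [hj]
  · simp

/-- At a maximum no coordinate can enter the normal form with a positive sign. -/
theorem IsMorseCriticalPoint.index_eq_of_isMax {k : ℕ} (hk : IsMorseCriticalPoint n f k p)
    (h : ∀ x, f x ≤ f p) : k = n := by
  obtain ⟨-, hkn, φ, hp, h0, hf⟩ := hk
  by_contra hne
  have hlt : k < n := lt_of_le_of_ne hkn hne
  obtain ⟨ε, hε, ⟨x, hx, hxi⟩, -⟩ := exists_chart_axis φ hp h0 ⟨k, hlt⟩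
  have h1 := hf x hx
  rw [hxi, sum_quadratic_single, if_neg (lt_irrefl k)] at h1
  nlinarith [h x, pow_pos hε 2]

/-- At a minimum no coordinate can enter the normal form with a negative sign. -/
theorem IsMorseCriticalPoint.index_eq_of_isMin {k : ℕ} (hk : IsMorseCriticalPoint n f k p)
    (h : ∀ x, f p ≤ f x) : k = 0 := by
  obtain ⟨-, hkn, φ, hp, h0, hf⟩ := hk
  by_contra hne
  have hlt : 0 < k := Nat.pos_of_ne_zero hne
  obtain ⟨ε, hε, ⟨x, hx, hxi⟩, -⟩ := exists_chart_axis φ hp h0 ⟨0, by omega⟩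
  have h1 := hf x hx
  rw [hxi, sum_quadratic_single, if_pos hlt] at h1
  nlinarith [h x, pow_pos hε 2]

end Extrema

/-! ### The height function on the three-dimensional sphere -/

/-- The unit sphere in four-dimensional space. -/
abbrev S3 : Type := Metric.sphere (0 : EuclideanSpace ℝ (Fin 4)) 1

theorem S3.sum_sq (q : S3) : ∑ i, q.1 i ^ 2 = 1 := by
  have h : ‖q.1‖ = 1 := mem_sphere_zero_iff_norm.1 q.2
  have := EuclideanSpace.real_norm_sq_eq q.1
  rw [h] at this
  linarith

theorem mem_S3_iff (x : EuclideanSpace ℝ (Fin 4)) :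
    x ∈ Metric.sphere (0 : EuclideanSpace ℝ (Fin 4)) 1 ↔ ∑ i, x i ^ 2 = 1 := by
  rw [mem_sphere_zero_iff_norm, ← EuclideanSpace.real_norm_sq_eq]
  constructor
  · intro h; rw [h, one_pow]
  · intro h; exact (pow_eq_one_iff_of_nonneg (norm_nonneg x) two_ne_zero).1 h

open Classical in
/-- A chart of the sphere whose inverse is given by a map `g` into the ambient space. Where `g`
leaves the sphere, the inverse takes the irrelevant value `p`. -/
def sphereChart (f : S3 → E 3) (g : E 3 → EuclideanSpace ℝ (Fin 4)) (O : Set S3) (T : Set (E 3))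
    (p : S3) (hO : IsOpen O) (hT : IsOpen T) (hf : ContinuousOn f O) (hg : ContinuousOn g T)
    (hfO : ∀ q ∈ O, f q ∈ T)
    (hgS : ∀ y ∈ T, g y ∈ Metric.sphere (0 : EuclideanSpace ℝ (Fin 4)) 1)
    (hgO : ∀ y (hy : y ∈ T), (⟨g y, hgS y hy⟩ : S3) ∈ O)
    (hgf : ∀ q ∈ O, g (f q) = q) (hfg : ∀ y (hy : y ∈ T), f ⟨g y, hgS y hy⟩ = y) :
    OpenPartialHomeomorph S3 (E 3) where
  toFun := f
  invFun y := if h : g y ∈ Metric.sphere (0 : EuclideanSpace ℝ (Fin 4)) 1 then ⟨g y, h⟩ else p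
  source := O
  target := T
  map_source' := hfO
  map_target' y hy := by
    rw [dif_pos (hgS y hy)]
    exact hgO y hy
  left_inv' q hq := by
    rw [dif_pos (hgS _ (hfO q hq))]
    exact Subtype.ext (hgf q hq)
  right_inv' y hy := by
    rw [dif_pos (hgS y hy)]
    exact hfg y hy
  open_source := hO
  open_target := hT
  continuousOn_toFun := hf
  continuousOn_invFun := by
    rw [Topology.IsInducing.subtypeVal.continuousOn_iff]
    refine hg.congr fun y hy => ?_
    rw [Function.comp_apply, dif_pos (hgS y hy)]

variable {C : ℝ}

/-- Away from the poles, one of the first three coordinates is nonzero, and the other coordinates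
form a chart, the height being one of them. -/
theorem height_regular (hC : 0 < C) (p : S3) {i : Fin 4} (hi : i ≠ 3) (hpi : p.1 i ≠ 0) :
    IsTopRegularPoint 3 (fun q : S3 => C * q.1 3) p := by
  obtain ⟨s, hs, hsp⟩ : ∃ s : ℝ, s * s = 1 ∧ 0 < s * p.1 i := by
    rcases lt_or_gt_of_ne hpi with h | h
    · exact ⟨-1, by norm_num, by linarith⟩
    · exact ⟨1, by norm_num, by linarith⟩
  -- `w y` holds the coordinates other than the `i`-th one, which is recovered with the sign `s`;
  -- the factor `C` turns the height coordinate into the increment of the function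
  let w : E 3 → Fin 3 → ℝ := fun y j => p.1 (i.succAbove j) + y j / C
  have hw : Continuous w := by fun_prop
  let g : E 3 → EuclideanSpace ℝ (Fin 4) := fun y =>
    WithLp.toLp 2 (i.insertNth (s * √(1 - ∑ j, w y j ^ 2)) (w y) : Fin 4 → ℝ)
  have hgi : ∀ y, g y i = s * √(1 - ∑ j, w y j ^ 2) := fun y => by simp [g]
  have hgj : ∀ y j, g y (i.succAbove j) = w y j := fun y j => by simp [g]
  have hlast : i.succAbove 2 = 3 := by
    revert hi; fin_cases i <;> decide
  let f : S3 → E 3 := fun q => WithLp.toLp 2 fun j =>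
    C * (q.1 (i.succAbove j) - p.1 (i.succAbove j))
  have hfa : ∀ q j, f q j = C * (q.1 (i.succAbove j) - p.1 (i.succAbove j)) := fun q j => rfl
  have hwf : ∀ q j, w (f q) j = q.1 (i.succAbove j) := by
    intro q j
    simp only [w, hfa]
    field_simp
    ring
  have hsum : ∀ q : S3, 1 - ∑ j, w (f q) j ^ 2 = q.1 i ^ 2 := by
    intro q
    have := q.sum_sq
    rw [Fin.sum_univ_succAbove _ i] at this
    simp only [hwf]
    linarith
  have hgS : ∀ y ∈ {y : E 3 | ∑ j, w y j ^ 2 < 1},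
      g y ∈ Metric.sphere (0 : EuclideanSpace ℝ (Fin 4)) 1 := by
    intro y hy
    rw [mem_S3_iff, Fin.sum_univ_succAbove _ i, hgi, mul_pow, sq s, hs, one_mul,
      Real.sq_sqrt (sub_nonneg.2 (le_of_lt hy))]
    simp only [hgj]
    ring
  refine ⟨sphereChart f g {q | 0 < s * q.1 i} {y | ∑ j, w y j ^ 2 < 1} p
    (isOpen_lt continuous_const (by fun_prop)) (isOpen_lt (by fun_prop) continuous_const)
    (by fun_prop) ?_ ?_ hgS ?_ ?_ ?_, 2, hsp, ?_, ?_⟩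
  · refine Continuous.continuousOn ?_
    refine (PiLp.continuous_toLp 2 _).comp (continuous_pi fun k => ?_)
    refine Fin.succAboveCases i ?_ (fun j => ?_) k
    · simp only [Fin.insertNth_apply_same]; fun_prop
    · simp only [Fin.insertNth_apply_succAbove]; fun_prop
  · intro q hq
    have : 0 < q.1 i ^ 2 := by
      have h0 : q.1 i ≠ 0 := fun h => by simp [h] at hq
      positivity
    rw [← hsum] at this
    exact sub_pos.1 this
  · intro y hy
    change 0 < s * g y i
    rw [hgi, ← mul_assoc, hs, one_mul]
    exact Real.sqrt_pos.2 (sub_pos.2 hy)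
  · intro q hq
    have hq' : 0 < s * q.1 i := hq
    refine PiLp.ext fun k => ?_
    refine Fin.succAboveCases i ?_ (fun j => ?_) k
    · rw [hgi, hsum]
      have : q.1 i ^ 2 = (s * q.1 i) ^ 2 := by rw [mul_pow, sq s, hs, one_mul]
      rw [this, Real.sqrt_sq hq'.le, ← mul_assoc, hs, one_mul]
    · rw [hgj, hwf]
  · intro y hy
    refine PiLp.ext fun j => ?_
    rw [hfa]
    change C * (g y (i.succAbove j) - _) = _
    rw [hgj]
    simp only [w]
    field_simp
    ring
  · refine PiLp.ext fun j => ?_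
    change C * (p.1 _ - p.1 _) = 0
    rw [sub_self, mul_zero]
  · intro q _
    change C * q.1 3 = C * p.1 3 + C * (q.1 (i.succAbove 2) - p.1 (i.succAbove 2))
    rw [hlast]
    ring

/-- At the pole of height `s`, where `s` is a sign, the coordinates `√C x / √(1 + s h)` put the
height function `C h` into the form `s C - s |y|²`. -/
theorem height_pole (hC : 0 < C) {s : ℝ} (hs : s * s = 1) (p : S3) (hp : p.1 3 = s) :
    ∃ φ : OpenPartialHomeomorph S3 (E 3), p ∈ φ.source ∧ φ p = 0 ∧
      ∀ q ∈ φ.source, C * q.1 3 = C * p.1 3 - s * ∑ j, φ q j ^ 2 := by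
  let r : E 3 → ℝ := fun y => 1 - (∑ j, y j ^ 2) / C
  have hr : Continuous r := by fun_prop
  let g : E 3 → EuclideanSpace ℝ (Fin 4) := fun y =>
    WithLp.toLp 2 (Fin.snoc (fun j => y j * √(1 + r y) / √C) (s * r y) : Fin 4 → ℝ)
  have hg3 : ∀ y, g y 3 = s * r y := fun y => by
    change (Fin.snoc (fun j => y j * √(1 + r y) / √C) (s * r y) : Fin 4 → ℝ) (Fin.last 3) = _
    rw [Fin.snoc_last]
  have hgj : ∀ y (j : Fin 3), g y j.castSucc = y j * √(1 + r y) / √C := fun y j => by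
    change (Fin.snoc (fun j => y j * √(1 + r y) / √C) (s * r y) : Fin 4 → ℝ) j.castSucc = _
    rw [Fin.snoc_castSucc]
  let f : S3 → E 3 := fun q => WithLp.toLp 2 fun j => √C * q.1 j.castSucc / √(1 + s * q.1 3)
  have hfa : ∀ q j, f q j = √C * q.1 j.castSucc / √(1 + s * q.1 3) := fun q j => rfl
  have hCs : √C ^ 2 = C := Real.sq_sqrt hC.le
  have hC0 : √C ≠ 0 := (Real.sqrt_pos.2 hC).ne'
  have hxs : ∀ q : S3, ∑ j : Fin 3, q.1 j.castSucc ^ 2 = 1 - q.1 3 ^ 2 := by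
    intro q
    have := q.sum_sq
    rw [Fin.sum_univ_castSucc] at this
    exact eq_sub_of_add_eq this
  have hsum : ∀ q : S3, 0 < 1 + s * q.1 3 → ∑ j, f q j ^ 2 = C * (1 - s * q.1 3) := by
    intro q hq
    simp only [hfa, div_pow, mul_pow, hCs, Real.sq_sqrt hq.le]
    rw [← Finset.sum_div, ← Finset.mul_sum, hxs, div_eq_iff hq.ne']
    linear_combination (C * q.1 3 ^ 2) * hs
  have hrf : ∀ q : S3, 0 < 1 + s * q.1 3 → r (f q) = s * q.1 3 := by
    intro q hq
    simp only [r]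
    rw [hsum q hq]
    field_simp
    ring
  have hrT : ∀ y, ∑ j, y j ^ 2 < 2 * C ↔ 0 < 1 + r y := by
    intro y
    have : 1 + r y = (2 * C - ∑ j, y j ^ 2) / C := by simp only [r]; field_simp; ring
    rw [this, div_pos_iff_of_pos_right hC, sub_pos]
  have hgS : ∀ y ∈ {y : E 3 | ∑ j, y j ^ 2 < 2 * C},
      g y ∈ Metric.sphere (0 : EuclideanSpace ℝ (Fin 4)) 1 := by
    intro y hy
    have h1 : 0 < 1 + r y := (hrT y).1 hy
    rw [mem_S3_iff, Fin.sum_univ_castSucc]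
    change _ + g y 3 ^ 2 = 1
    simp only [hg3, hgj, div_pow, mul_pow, hCs, Real.sq_sqrt h1.le, sq s, hs]
    rw [← Finset.sum_div, ← Finset.sum_mul]
    have h2 : ∑ j, y j ^ 2 = C * (1 - r y) := by simp only [r]; field_simp; ring
    rw [h2]
    field_simp
    ring
  refine ⟨sphereChart f g {q | 0 < 1 + s * q.1 3} {y | ∑ j, y j ^ 2 < 2 * C} p
    (isOpen_lt continuous_const (by fun_prop)) (isOpen_lt (by fun_prop) continuous_const)
    ?_ ?_ ?_ hgS ?_ ?_ ?_, ?_, ?_, ?_⟩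
  · refine (PiLp.continuous_toLp 2 _).comp_continuousOn (continuousOn_pi.2 fun j => ?_)
    refine ContinuousOn.div (by fun_prop) (by fun_prop) fun q hq => ?_
    exact (Real.sqrt_pos.2 hq).ne'
  · refine Continuous.continuousOn ?_
    refine (PiLp.continuous_toLp 2 _).comp (continuous_pi fun k => ?_)
    refine Fin.lastCases ?_ (fun j => ?_) k
    · simp only [Fin.snoc_last]; fun_prop
    · simp only [Fin.snoc_castSucc]; fun_prop
  · intro q hq
    rw [mem_ofPred_eq, hrT, hrf q hq]
    exact hq
  · intro y hy
    change 0 < 1 + s * g y 3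
    rw [hg3, ← mul_assoc, hs, one_mul]
    exact (hrT y).1 hy
  · intro q hq
    have hq' : 0 < √(1 + s * q.1 3) := Real.sqrt_pos.2 hq
    refine PiLp.ext fun k => ?_
    refine Fin.lastCases ?_ (fun j => ?_) k
    · change g (f q) 3 = q.1 3
      rw [hg3, hrf q hq, ← mul_assoc, hs, one_mul]
    · rw [hgj, hrf q hq, hfa]
      field_simp
  · intro y hy
    have h1 : 0 < √(1 + r y) := Real.sqrt_pos.2 ((hrT y).1 hy)
    refine PiLp.ext fun j => ?_
    rw [hfa]
    change √C * g y j.castSucc / √(1 + s * g y 3) = _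
    rw [hgj, hg3, ← mul_assoc, hs, one_mul]
    field_simp
  · change 0 < 1 + s * p.1 3
    rw [hp, hs]
    norm_num
  · refine PiLp.ext fun j => ?_
    change √C * p.1 j.castSucc / √(1 + s * p.1 3) = 0
    have h0 : p.1 j.castSucc ^ 2 = 0 := by
      have h1 := hxs p
      rw [hp, sq s, hs, sub_self] at h1
      exact (Finset.sum_eq_zero_iff_of_nonneg fun _ _ => sq_nonneg _).1 h1 j (Finset.mem_univ _)
    rw [pow_eq_zero_iff two_ne_zero] at h0
    rw [h0, mul_zero, zero_div]
  · intro q hq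
    change C * q.1 3 = C * p.1 3 - s * ∑ j, f q j ^ 2
    rw [hsum q hq, hp]
    linear_combination (-(C * q.1 3)) * hs

/-! ### Functions that are a height function up to homeomorphism -/

section Transport

variable {M : Type} [TopologicalSpace M]

theorem IsTopRegularPoint.comp_homeomorph {N : Type} [TopologicalSpace N] (h : M ≃ₜ N) {n : ℕ}
    {f : N → ℝ} {p : M} (hf : IsTopRegularPoint n f (h p)) :
    IsTopRegularPoint n (fun x => f (h x)) p := by
  obtain ⟨φ, i, hp, h0, hφ⟩ := hf
  exact ⟨h.transOpenPartialHomeomorph φ, i, hp, h0, fun x hx => hφ (h x) hx⟩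

/-- A function that a homeomorphism to the sphere turns into a positive multiple of the height is
an exact Morse function, with one maximum and one minimum as its critical points. -/
theorem exactTopMorse_of_height (e : M ≃ₜ S3) (hC : 0 < C) {f : M → ℝ}
    (hf : ∀ x, f x = C * (e x).1 3) :
    IsExactTopMorse 3 f ∧ ∃ P Q : M, P ≠ Q ∧ {R | IsTopCriticalPoint 3 f R} = {P, Q} ∧
      IsMorseCriticalPoint 3 f 3 P ∧ (∀ R, f R ≤ f P) ∧
      IsMorseCriticalPoint 3 f 0 Q ∧ (∀ R, f Q ≤ f R) := by
  obtain rfl : f = fun x => C * (e x).1 3 := funext hf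
  clear hf
  have hpole : ∀ s : ℝ, s * s = 1 →
      EuclideanSpace.single 3 s ∈ Metric.sphere (0 : EuclideanSpace ℝ (Fin 4)) 1 := by
    intro s hs
    rw [mem_S3_iff, Finset.sum_eq_single 3]
    · simp [sq, hs]
    · intro j _ hj; simp [hj]
    · simp
  set N : S3 := ⟨EuclideanSpace.single 3 1, hpole 1 (by norm_num)⟩ with hN
  set S : S3 := ⟨EuclideanSpace.single 3 (-1), hpole (-1) (by norm_num)⟩ with hS
  have hN3 : N.1 3 = 1 := by simp [hN]
  have hS3 : S.1 3 = -1 := by simp [hS]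
  have hbound : ∀ q : S3, |q.1 3| ≤ 1 := by
    intro q
    rw [← sq_le_one_iff_abs_le_one]
    exact (Finset.single_le_sum (f := fun i => q.1 i ^ 2) (fun i _ => sq_nonneg _)
      (Finset.mem_univ 3)).trans_eq q.sum_sq
  have hmax : ∀ R, C * (e R).1 3 ≤ C * (e (e.symm N)).1 3 := by
    intro R
    rw [e.apply_symm_apply, hN3]
    exact mul_le_mul_of_nonneg_left (abs_le.1 (hbound _)).2 hC.le
  have hmin : ∀ R, C * (e (e.symm S)).1 3 ≤ C * (e R).1 3 := by
    intro R
    rw [e.apply_symm_apply, hS3]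
    exact mul_le_mul_of_nonneg_left (abs_le.1 (hbound _)).1 hC.le
  have hPQ : e.symm N ≠ e.symm S := by
    intro h
    have := congrArg (fun q : S3 => q.1 3) (e.symm.injective h)
    simp only [hN3, hS3] at this
    norm_num at this
  have hP : IsMorseCriticalPoint 3 (fun x => C * (e x).1 3) 3 (e.symm N) := by
    obtain ⟨φ, hp, h0, hφ⟩ := height_pole hC (s := 1) (by norm_num) N hN3
    refine ⟨isTopCriticalPoint_of_isMax hmax, le_rfl, e.transOpenPartialHomeomorph φ, ?_, ?_,
      fun x hx => ?_⟩
    · change e (e.symm N) ∈ φ.source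
      rwa [e.apply_symm_apply]
    · change φ (e (e.symm N)) = 0
      rwa [e.apply_symm_apply]
    · change C * (e x).1 3 = C * (e (e.symm N)).1 3 +
        ∑ i : Fin 3, if (i : ℕ) < 3 then -(φ (e x) i) ^ 2 else _
      rw [e.apply_symm_apply, hφ (e x) hx, one_mul, sub_eq_add_neg, ← Finset.sum_neg_distrib]
      congr 1
  have hQ : IsMorseCriticalPoint 3 (fun x => C * (e x).1 3) 0 (e.symm S) := by
    obtain ⟨φ, hp, h0, hφ⟩ := height_pole hC (s := -1) (by norm_num) S hS3
    refine ⟨isTopCriticalPoint_of_isMin hmin, Nat.zero_le _, e.transOpenPartialHomeomorph φ, ?_,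
      ?_, fun x hx => ?_⟩
    · change e (e.symm S) ∈ φ.source
      rwa [e.apply_symm_apply]
    · change φ (e (e.symm S)) = 0
      rwa [e.apply_symm_apply]
    · change C * (e x).1 3 = C * (e (e.symm S)).1 3 +
        ∑ i : Fin 3, if (i : ℕ) < 0 then _ else (φ (e x) i) ^ 2
      rw [e.apply_symm_apply, hφ (e x) hx, neg_one_mul, sub_neg_eq_add]
      congr 1
  have hreg : ∀ R, R ≠ e.symm N → R ≠ e.symm S →
      IsTopRegularPoint 3 (fun x => C * (e x).1 3) R := by
    intro R hRN hRS
    suffices h : ∃ i : Fin 4, i ≠ 3 ∧ (e R).1 i ≠ 0 by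
      obtain ⟨i, hi, hR⟩ := h
      exact (height_regular hC (e R) hi hR).comp_homeomorph e
    -- a point with vanishing first coordinates is a pole
    by_contra! h
    have hsq : (e R).1 3 ^ 2 = 1 := by
      refine Eq.trans (Eq.symm ?_) (e R).sum_sq
      refine Finset.sum_eq_single 3 (fun j _ hj => ?_) (by simp)
      rw [h j hj]
      norm_num
    have hext : ∀ s : ℝ, (e R).1 3 = s → (e R).1 = EuclideanSpace.single 3 s := by
      intro s hs
      refine PiLp.ext fun i => ?_
      by_cases hi : i = 3
      · subst hi; simp [hs]
      · rw [h i hi]; simp [hi]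
    rcases sq_eq_one_iff.1 hsq with h1 | h1
    · exact hRN ((e.symm_apply_eq.2 (Subtype.ext (hext _ h1).symm)).symm)
    · exact hRS ((e.symm_apply_eq.2 (Subtype.ext (hext _ h1).symm)).symm)
  have hcases : ∀ R, R = e.symm N ∨ R = e.symm S ∨
      IsTopRegularPoint 3 (fun x => C * (e x).1 3) R := fun R => by
    by_cases h1 : R = e.symm N
    · exact Or.inl h1
    · by_cases h2 : R = e.symm S
      · exact Or.inr (Or.inl h2)
      · exact Or.inr (Or.inr (hreg R h1 h2))
  refine ⟨⟨⟨by fun_prop, fun R => ?_⟩, fun k => ?_⟩, e.symm N, e.symm S, hPQ, ?_, hP, hmax, hQ,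
    hmin⟩
  · rcases hcases R with rfl | rfl | h
    · exact Or.inr ⟨3, hP⟩
    · exact Or.inr ⟨0, hQ⟩
    · exact Or.inl h
  · rw [SphereHomology.bettiNumber_of_homeomorph_sphere e]
    have hk : ∀ R, IsMorseCriticalPoint 3 (fun x => C * (e x).1 3) k R ↔
        (k = 3 ∧ R = e.symm N) ∨ (k = 0 ∧ R = e.symm S) := by
      intro R
      constructor
      · intro h
        rcases hcases R with rfl | rfl | hR
        · exact Or.inl ⟨h.index_eq_of_isMax hmax, rfl⟩
        · exact Or.inr ⟨h.index_eq_of_isMin hmin, rfl⟩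
        · exact absurd hR h.1
      · rintro (⟨rfl, rfl⟩ | ⟨rfl, rfl⟩)
        · exact hP
        · exact hQ
    simp only [hk]
    by_cases h3 : k = 3
    · subst h3
      simp
    · by_cases h0 : k = 0
      · subst h0
        simp
      · simp [h3, h0]
  · ext R
    constructor
    · intro h
      rcases hcases R with rfl | rfl | hR
      · exact Or.inl rfl
      · exact Or.inr rfl
      · exact absurd hR h
    · rintro (rfl | rfl)
      · exact hP.1
      · exact hQ.1

end Transport

end RobotArm

end

/-! ### The elliptope and the sphere -/

noncomputable section

namespace RobotArm

open Set Filter Topology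

/-- The determinant of the symmetric `3 × 3` matrix with unit diagonal and off-diagonal entries
`x 0`, `x 1`, `x 2`. -/
def ellDet (x : E 3) : ℝ := 1 + 2 * (x 0 * x 1 * x 2) - (x 0 ^ 2 + x 1 ^ 2 + x 2 ^ 2)

/-- The elliptope: the off-diagonal entries of the positive semidefinite `3 × 3` matrices with unit
diagonal, described by their principal minors. -/
def elliptope : Set (E 3) := {x | (∀ i, |x i| ≤ 1) ∧ 0 ≤ ellDet x}

@[fun_prop]
theorem continuous_ellDet : Continuous ellDet := by
  unfold ellDet
  fun_prop

theorem ellDet_zero : ellDet 0 = 1 := by simp [ellDet]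

theorem isClosed_elliptope : IsClosed elliptope := by
  have : elliptope = (⋂ i, {x : E 3 | |x i| ≤ 1}) ∩ {x | 0 ≤ ellDet x} := by
    ext x; simp [elliptope]
  rw [this]
  exact (isClosed_iInter fun i => isClosed_le (by fun_prop) continuous_const).inter
    (isClosed_le continuous_const continuous_ellDet)

/-- The sum of the three inequalities of the form `2uvw ≤ u² + v²`, valid for `|w| ≤ 1`. -/
theorem three_mul_le_sum_sq {a b c : ℝ} (ha : |a| ≤ 1) (hb : |b| ≤ 1) (hc : |c| ≤ 1) :
    3 * (a * b * c) ≤ a ^ 2 + b ^ 2 + c ^ 2 := by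
  have h : ∀ u v w : ℝ, |w| ≤ 1 → 2 * (u * v * w) ≤ u ^ 2 + v ^ 2 := by
    intro u v w hw
    obtain ⟨h1, h2⟩ := abs_le.1 hw
    nlinarith [mul_nonneg (sub_nonneg.2 h2) (sq_nonneg (u - v)),
      mul_nonneg (by linarith : 0 ≤ 1 + w) (sq_nonneg (u + v)), sq_nonneg (u - v),
      sq_nonneg (u + v)]
  linarith [h a b c hc, h b c a ha, h a c b hb]

/-- The determinant strictly decreases along rays from the origin inside the cube. -/
theorem ellDet_lt_smul {x : E 3} (hx : ∀ i, |x i| ≤ 1) (hx0 : x ≠ 0) {t : ℝ} (ht0 : 0 ≤ t)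
    (ht1 : t < 1) : ellDet x < ellDet (t • x) := by
  have hn : 0 < x 0 ^ 2 + x 1 ^ 2 + x 2 ^ 2 := by
    have h : 0 < ‖x‖ ^ 2 := pow_pos (norm_pos_iff.2 hx0) 2
    rwa [EuclideanSpace.real_norm_sq_eq, Fin.sum_univ_three] at h
  have h3 := three_mul_le_sum_sq (hx 0) (hx 1) (hx 2)
  have hdiff : ellDet (t • x) - ellDet x = (1 - t) * ((1 + t) * (x 0 ^ 2 + x 1 ^ 2 + x 2 ^ 2) -
      2 * (1 + t + t ^ 2) * (x 0 * x 1 * x 2)) := by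
    simp only [ellDet, PiLp.smul_apply, smul_eq_mul]
    ring
  have hpos : 0 < (1 + t) * (x 0 ^ 2 + x 1 ^ 2 + x 2 ^ 2) -
      2 * (1 + t + t ^ 2) * (x 0 * x 1 * x 2) := by
    rcases le_or_gt (x 0 * x 1 * x 2) 0 with hp | hp
    · have h1 : 0 < (1 + t) * (x 0 ^ 2 + x 1 ^ 2 + x 2 ^ 2) := by positivity
      have h2 : 2 * (1 + t + t ^ 2) * (x 0 * x 1 * x 2) ≤ 0 :=
        mul_nonpos_of_nonneg_of_nonpos (by positivity) hp
      linarith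
    · have h1 : (1 + t) * (3 * (x 0 * x 1 * x 2)) ≤ (1 + t) * (x 0 ^ 2 + x 1 ^ 2 + x 2 ^ 2) :=
        mul_le_mul_of_nonneg_left h3 (by positivity)
      have h2 : 0 < (1 - t) * (1 + 2 * t) * (x 0 * x 1 * x 2) :=
        mul_pos (mul_pos (by linarith) (by linarith)) hp
      nlinarith
  have := mul_pos (sub_pos.2 ht1) hpos
  linarith

theorem ellDet_lt_one {x : E 3} (hx : ∀ i, |x i| ≤ 1) (hx0 : x ≠ 0) : ellDet x < 1 := by
  have := ellDet_lt_smul hx hx0 le_rfl one_pos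
  rwa [zero_smul, ellDet_zero] at this

theorem ellDet_le_one {x : E 3} (hx : ∀ i, |x i| ≤ 1) : ellDet x ≤ 1 := by
  by_cases hx0 : x = 0
  · rw [hx0, ellDet_zero]
  · exact (ellDet_lt_one hx hx0).le

/-- On the faces of the cube the determinant is minus a square. -/
theorem ellDet_nonpos_of_abs_eq_one {x : E 3} {i : Fin 3} (hi : |x i| = 1) : ellDet x ≤ 0 := by
  have h : x i ^ 2 = 1 := by rw [← sq_abs, hi, one_pow]
  unfold ellDet
  fin_cases i <;> simp only [Fin.zero_eta, Fin.mk_one, Fin.reduceFinMk] at h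
  · have : 1 + 2 * (x 0 * x 1 * x 2) - (x 0 ^ 2 + x 1 ^ 2 + x 2 ^ 2) =
        -(x 1 - x 0 * x 2) ^ 2 := by linear_combination (x 2 ^ 2 - 1) * h
    rw [this]; exact neg_nonpos.2 (sq_nonneg _)
  · have : 1 + 2 * (x 0 * x 1 * x 2) - (x 0 ^ 2 + x 1 ^ 2 + x 2 ^ 2) =
        -(x 0 - x 1 * x 2) ^ 2 := by linear_combination (x 2 ^ 2 - 1) * h
    rw [this]; exact neg_nonpos.2 (sq_nonneg _)
  · have : 1 + 2 * (x 0 * x 1 * x 2) - (x 0 ^ 2 + x 1 ^ 2 + x 2 ^ 2) =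
        -(x 0 - x 1 * x 2) ^ 2 := by linear_combination (x 1 ^ 2 - 1) * h
    rw [this]; exact neg_nonpos.2 (sq_nonneg _)

/-- A point of positive determinant is interior, since it lies off the faces of the cube; at a point
of zero determinant the determinant becomes negative further out on the ray. -/
theorem frontier_elliptope_iff {x : E 3} (hx : x ∈ elliptope) :
    x ∈ frontier elliptope ↔ ellDet x = 0 := by
  rw [frontier, isClosed_elliptope.closure_eq, Set.mem_sdiff]
  simp only [hx, true_and]
  constructor
  · intro h
    by_contra h0
    have hpos : 0 < ellDet x := lt_of_le_of_ne hx.2 (Ne.symm h0)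
    refine h (mem_interior.2 ⟨(⋂ i, {y : E 3 | |y i| < 1}) ∩ {y | 0 < ellDet y}, ?_, ?_, ?_⟩)
    · rintro y ⟨h1, h2⟩
      exact ⟨fun i => le_of_lt (mem_iInter.1 h1 i), le_of_lt h2⟩
    · exact (isOpen_iInter_of_finite fun i => isOpen_lt (by fun_prop) continuous_const).inter
        (isOpen_lt continuous_const continuous_ellDet)
    · refine ⟨mem_iInter.2 fun i => lt_of_le_of_ne (hx.1 i) fun hi => ?_, hpos⟩
      exact absurd (ellDet_nonpos_of_abs_eq_one hi) (not_le.2 hpos)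
  · intro h0 hint
    have hx0 : x ≠ 0 := by
      rintro rfl
      rw [ellDet_zero] at h0
      exact one_ne_zero h0
    have hc : Continuous fun t : ℝ => t • x := by fun_prop
    have hev : ∀ᶠ t in 𝓝 (1 : ℝ), t • x ∈ elliptope :=
      hc.continuousAt.eventually_mem (by
        rw [one_smul]; exact mem_interior_iff_mem_nhds.1 hint)
    obtain ⟨t, ht, ht1⟩ := ((hev.filter_mono nhdsWithin_le_nhds).and
      (self_mem_nhdsWithin : ∀ᶠ t in 𝓝[>] (1 : ℝ), t ∈ Ioi 1)).exists
    have ht1 : 1 < t := ht1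
    have ht0 : t ≠ 0 := by linarith
    have := ellDet_lt_smul ht.1 (smul_ne_zero ht0 hx0) (inv_nonneg.2 (by linarith))
      (inv_lt_one_of_one_lt₀ ht1)
    rw [smul_smul, inv_mul_cancel₀ ht0, one_smul, h0] at this
    exact absurd ht.2 (not_le.2 this)

/-- The map `(x, v) ↦ (√(1 - v²) x / ‖x‖, v)`, which carries the hypersurface `v² = ellDet x` over
the elliptope to the unit sphere. At `x = 0`, where `v² = 1`, the first component is zero. -/
def sph (x : E 3) (v : ℝ) : EuclideanSpace ℝ (Fin 4) :=
  WithLp.toLp 2 (Fin.snoc (fun j => √(1 - v ^ 2) * (‖x‖⁻¹ * x j)) v : Fin 4 → ℝ)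

theorem sph_castSucc (x : E 3) (v : ℝ) (j : Fin 3) :
    sph x v j.castSucc = √(1 - v ^ 2) * (‖x‖⁻¹ * x j) := by
  change (Fin.snoc (fun j => √(1 - v ^ 2) * (‖x‖⁻¹ * x j)) v : Fin 4 → ℝ) j.castSucc = _
  rw [Fin.snoc_castSucc]

theorem sph_last (x : E 3) (v : ℝ) : sph x v 3 = v := by
  change (Fin.snoc (fun j => √(1 - v ^ 2) * (‖x‖⁻¹ * x j)) v : Fin 4 → ℝ) (Fin.last 3) = _
  rw [Fin.snoc_last]

theorem sph_mem {x : E 3} {v : ℝ} (hx : x ∈ elliptope) (hv : v ^ 2 = ellDet x) :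
    sph x v ∈ Metric.sphere (0 : EuclideanSpace ℝ (Fin 4)) 1 := by
  have h1 : 0 ≤ 1 - v ^ 2 := by rw [hv, sub_nonneg]; exact ellDet_le_one hx.1
  rw [mem_S3_iff, Fin.sum_univ_castSucc]
  change _ + sph x v 3 ^ 2 = 1
  simp only [sph_castSucc, sph_last, mul_pow, Real.sq_sqrt h1]
  rw [← Finset.mul_sum, ← Finset.mul_sum, ← EuclideanSpace.real_norm_sq_eq]
  by_cases hx0 : x = 0
  · rw [hv, hx0, ellDet_zero]; simp
  · have : ‖x‖ ≠ 0 := norm_ne_zero_iff.2 hx0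
    field_simp
    ring

/-- Continuity at the poles, where the direction `x / ‖x‖` has no limit, holds because the factor
`√(1 - v²)` vanishes there. -/
theorem continuous_sph {Z : Type*} [TopologicalSpace Z] {x : Z → E 3} {v : Z → ℝ}
    (hx : Continuous x) (hv : Continuous v) (h : ∀ z, v z ^ 2 = ellDet (x z)) :
    Continuous fun z => sph (x z) (v z) := by
  refine (PiLp.continuous_toLp 2 _).comp (continuous_pi fun k => ?_)
  refine Fin.lastCases ?_ (fun j => ?_) k
  · simpa only [Fin.snoc_last] using hv
  · simp only [Fin.snoc_castSucc]
    have hs : Continuous fun z => √(1 - v z ^ 2) := by fun_prop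
    refine continuous_iff_continuousAt.2 fun z => ?_
    by_cases hz : x z = 0
    · have h0 : √(1 - v z ^ 2) = 0 := by rw [h, hz, ellDet_zero, sub_self, Real.sqrt_zero]
      rw [ContinuousAt, h0, zero_mul]
      refine squeeze_zero_norm (a := fun z => √(1 - v z ^ 2)) (fun y => ?_)
        (h0 ▸ hs.tendsto z)
      rw [norm_mul, Real.norm_of_nonneg (Real.sqrt_nonneg _)]
      refine mul_le_of_le_one_right (Real.sqrt_nonneg _) ?_
      rw [norm_mul, norm_inv, norm_norm]
      exact (mul_le_mul_of_nonneg_left (PiLp.norm_apply_le (x y) j)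
        (inv_nonneg.2 (norm_nonneg _))).trans inv_mul_le_one
    · refine hs.continuousAt.mul (ContinuousAt.mul ?_ ?_)
      · exact hx.norm.continuousAt.inv₀ (norm_ne_zero_iff.2 hz)
      · fun_prop

/-- Along a ray, the points of the elliptope are separated by their determinant. -/
theorem eq_of_smul_eq {x y : E 3} (hx : x ∈ elliptope) (hy : y ∈ elliptope) (hx0 : x ≠ 0)
    (hy0 : y ≠ 0) (hxy : ‖x‖⁻¹ • x = ‖y‖⁻¹ • y) (hd : ellDet x = ellDet y) : x = y := by
  wlog hle : ‖x‖ ≤ ‖y‖ generalizing x y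
  · exact (this hy hx hy0 hx0 hxy.symm hd.symm (le_of_not_ge hle)).symm
  have hnx : ‖x‖ ≠ 0 := norm_ne_zero_iff.2 hx0
  have hny : 0 < ‖y‖ := norm_pos_iff.2 hy0
  have hx' : x = (‖x‖ / ‖y‖) • y := by
    rw [div_eq_mul_inv, mul_smul, ← hxy, smul_smul, mul_inv_cancel₀ hnx, one_smul]
  rcases hle.eq_or_lt with h | h
  · rw [hx', h, div_self hny.ne', one_smul]
  · have := ellDet_lt_smul hy.1 hy0 (t := ‖x‖ / ‖y‖) (by positivity) ((div_lt_one hny).2 h)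
    rw [← hx', hd] at this
    exact absurd this (lt_irrefl _)

theorem sph_injOn {x y : E 3} {v w : ℝ} (hx : x ∈ elliptope) (hv : v ^ 2 = ellDet x)
    (hy : y ∈ elliptope) (hw : w ^ 2 = ellDet y) (h : sph x v = sph y w) : x = y ∧ v = w := by
  have hvw : v = w := by rw [← sph_last x v, h, sph_last]
  subst hvw
  refine ⟨?_, rfl⟩
  have hd : ellDet x = ellDet y := hv.symm.trans hw
  by_cases hx0 : x = 0
  · by_contra hne
    have hy0 : y ≠ 0 := fun h => hne (hx0.trans h.symm)
    have := ellDet_lt_one hy.1 hy0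
    rw [← hd, hx0, ellDet_zero] at this
    exact lt_irrefl _ this
  · have hlt := ellDet_lt_one hx.1 hx0
    have hy0 : y ≠ 0 := by
      rintro rfl
      rw [hd, ellDet_zero] at hlt
      exact lt_irrefl _ hlt
    have hs : √(1 - v ^ 2) ≠ 0 := (Real.sqrt_pos.2 (by rw [hv]; linarith)).ne'
    refine eq_of_smul_eq hx hy hx0 hy0 (PiLp.ext fun j => ?_) hd
    have := congrArg (fun q : EuclideanSpace ℝ (Fin 4) => q j.castSucc) h
    simp only [sph_castSucc] at this
    exact mul_left_cancel₀ hs this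

/-- On the ray in the direction of the first three coordinates, the determinant falls from `1` to a
nonpositive value at the face of the cube, and so takes the value `v²` in between. -/
theorem exists_sph_eq (q : S3) : ∃ x ∈ elliptope, q.1 3 ^ 2 = ellDet x ∧ sph x (q.1 3) = q.1 := by
  have hq := q.sum_sq
  rw [Fin.sum_univ_castSucc] at hq
  change _ + q.1 3 ^ 2 = 1 at hq
  set v := q.1 3 with hv
  set w : E 3 := WithLp.toLp 2 fun j => q.1 j.castSucc with hw
  have hwj : ∀ j, w j = q.1 j.castSucc := fun j => rfl
  have hwn : ‖w‖ ^ 2 = 1 - v ^ 2 := by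
    rw [EuclideanSpace.real_norm_sq_eq]
    simp only [hwj]
    linarith
  suffices h : ∃ x ∈ elliptope, v ^ 2 = ellDet x ∧ ‖w‖ • ‖x‖⁻¹ • x = w by
    obtain ⟨x, hx, hvx, hxw⟩ := h
    refine ⟨x, hx, hvx, PiLp.ext fun k => ?_⟩
    refine Fin.lastCases ?_ (fun j => ?_) k
    · exact sph_last x v
    · rw [sph_castSucc, ← hwn, Real.sqrt_sq (norm_nonneg _), ← hwj,
        ← congrArg (fun y : E 3 => y j) hxw]
      simp
  by_cases hw0 : w = 0
  · refine ⟨0, ⟨by simp, by rw [ellDet_zero]; exact zero_le_one⟩, ?_, by simp [hw0]⟩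
    rw [hw0, norm_zero] at hwn
    rw [ellDet_zero]
    linarith
  · obtain ⟨i, -, hi⟩ := Finset.exists_max_image Finset.univ (fun i => |w i|) ⟨0, Finset.mem_univ _⟩
    have hm : 0 < |w i| := by
      by_contra h
      refine hw0 (PiLp.ext fun j => ?_)
      have := hi j (Finset.mem_univ _)
      exact abs_nonpos_iff.1 (this.trans (not_lt.1 h))
    have hcont : ContinuousOn (fun t : ℝ => ellDet (t • w)) (Icc 0 |w i|⁻¹) := by fun_prop
    have hend : ellDet (|w i|⁻¹ • w) ≤ 0 := by
      refine ellDet_nonpos_of_abs_eq_one (i := i) ?_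
      rw [PiLp.smul_apply, smul_eq_mul, abs_mul, abs_inv, abs_abs, inv_mul_cancel₀ hm.ne']
    obtain ⟨t, ⟨ht0, ht1⟩, ht⟩ := intermediate_value_Icc' (inv_nonneg.2 hm.le) hcont
      (show v ^ 2 ∈ Icc _ _ from ⟨hend.trans (sq_nonneg v), by
        rw [zero_smul, ellDet_zero]; nlinarith [sq_nonneg ‖w‖]⟩)
    simp only at ht
    refine ⟨t • w, ⟨fun j => ?_, ht ▸ sq_nonneg v⟩, ht.symm, ?_⟩
    · rw [PiLp.smul_apply, smul_eq_mul, abs_mul, abs_of_nonneg ht0]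
      calc t * |w j| ≤ |w i|⁻¹ * |w i| :=
            mul_le_mul ht1 (hi j (Finset.mem_univ _)) (abs_nonneg _) (inv_nonneg.2 hm.le)
        _ = 1 := inv_mul_cancel₀ hm.ne'
    · have htpos : 0 < t := by
        refine lt_of_le_of_ne ht0 fun h => hw0 ?_
        rw [← h, zero_smul, ellDet_zero] at ht
        rw [← ht, sub_self] at hwn
        exact norm_eq_zero.1 (pow_eq_zero_iff two_ne_zero |>.1 hwn)
      have hwpos : ‖w‖ ≠ 0 := norm_ne_zero_iff.2 hw0
      rw [norm_smul, Real.norm_of_nonneg ht0, smul_smul, smul_smul]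
      have : ‖w‖ * (t * ‖w‖)⁻¹ * t = 1 := by field_simp
      rw [this, one_smul]

end RobotArm

end

/-! ### Arms with a given Gram matrix -/

noncomputable section

namespace RobotArm

open Set Filter Topology

/-- Vectors with the same inner products are related by a linear isometry. -/
theorem exists_linearIsometryEquiv_of_inner_eq {n d : ℕ} {v w : Fin n → E d}
    (h : ∀ i j, inner ℝ (v i) (v j) = inner ℝ (w i) (w j)) :
    ∃ A : E d ≃ₗᵢ[ℝ] E d, ∀ i, A (v i) = w i := by
  let Tv := Fintype.linearCombination ℝ v
  let Tw := Fintype.linearCombination ℝ w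
  have hT : ∀ c, ‖Tv c‖ = ‖Tw c‖ := by
    intro c
    have hin : inner ℝ (Tv c) (Tv c) = inner ℝ (Tw c) (Tw c) := by
      simp only [Tv, Tw, Fintype.linearCombination_apply, sum_inner, inner_sum, inner_smul_left,
        inner_smul_right, h]
    rw [real_inner_self_eq_norm_sq, real_inner_self_eq_norm_sq] at hin
    exact (pow_left_inj₀ (norm_nonneg _) (norm_nonneg _) two_ne_zero).1 hin
  obtain ⟨s, hs⟩ := Tv.rangeRestrict.exists_rightInverse_of_surjective Tv.range_rangeRestrict
  have hs' : ∀ y, Tv (s y) = y := fun y => congrArg Subtype.val (LinearMap.congr_fun hs y)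
  let L : LinearMap.range Tv →ₗᵢ[ℝ] E d :=
    ⟨Tw ∘ₗ s, fun y => by
      rw [LinearMap.comp_apply, ← hT, hs']; rfl⟩
  have hL : ∀ c, L ⟨Tv c, c, rfl⟩ = Tw c := by
    intro c
    change Tw (s ⟨Tv c, c, rfl⟩) = Tw c
    rw [← sub_eq_zero, ← map_sub, ← norm_eq_zero, ← hT, map_sub, hs', sub_self, norm_zero]
  refine ⟨L.extend.toLinearIsometryEquiv rfl, fun i => ?_⟩
  have hv : Tv (Pi.single i 1) = v i := by simp [Tv]
  have hw : Tw (Pi.single i 1) = w i := by simp [Tw]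
  rw [LinearIsometry.coe_toLinearIsometryEquiv, ← hv, ← hw, ← hL]
  exact L.extend_apply ⟨_, _⟩

variable {l : Fin 3 → ℝ}

theorem chainVolume_eq_det (p : Chain l 3) :
    chainVolume p = (EuclideanSpace.basisFun (Fin 3) ℝ).toBasis.det (armVec p) := by
  rw [Module.Basis.det_apply, ← Matrix.det_transpose]
  rfl

theorem chainVolume_eq_zero_iff (p : Chain l 3) :
    chainVolume p = 0 ↔ Submodule.span ℝ (range (armVec p)) ≠ ⊤ := by
  have h := (EuclideanSpace.basisFun (Fin 3) ℝ).toBasis.is_basis_iff_det (v := armVec p)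
  rw [← chainVolume_eq_det, isUnit_iff_ne_zero] at h
  rw [ne_eq, ← not_iff_not, not_not, ← ne_eq, ← h]
  refine ⟨fun h => h.2, fun h => ⟨?_, h⟩⟩
  refine linearIndependent_of_top_le_span_of_card_eq_finrank h.ge ?_
  simp

theorem norm_armVec (p : Chain l 3) (i : Fin 3) : ‖armVec p i‖ = l i := by
  rw [← p.2 i, dist_comm, dist_eq_norm]
  rfl

theorem gramPoint_apply (p : Chain l 3) :
    gramPoint p 0 = inner ℝ (armVec p 1) (armVec p 2) ∧
    gramPoint p 1 = inner ℝ (armVec p 0) (armVec p 2) ∧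
    gramPoint p 2 = inner ℝ (armVec p 0) (armVec p 1) := ⟨rfl, rfl, rfl⟩

theorem continuous_armVec (i : Fin 3) : Continuous fun p : Chain l 3 => armVec p i := by
  exact ((continuous_apply i.succ).comp continuous_subtype_val).sub
    ((continuous_apply i.castSucc).comp continuous_subtype_val)

theorem continuous_gramPoint : Continuous (gramPoint : Chain l 3 → E 3) := by
  refine (PiLp.continuous_toLp 2 _).comp (continuous_pi fun i => ?_)
  fin_cases i
  · exact (continuous_armVec 1).inner (continuous_armVec 2)
  · exact (continuous_armVec 0).inner (continuous_armVec 2)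
  · exact (continuous_armVec 0).inner (continuous_armVec 1)

theorem continuous_chainVolume : Continuous (chainVolume : Chain l 3 → ℝ) := by
  refine Continuous.matrix_det (continuous_matrix fun i j => ?_)
  exact (PiLp.continuous_apply 2 _ j).comp (continuous_armVec i)

theorem inner_armVec_eq {p q : Chain l 3} (h : gramPoint p = gramPoint q) (i j : Fin 3) :
    inner ℝ (armVec p i) (armVec p j) = inner ℝ (armVec q i) (armVec q j) := by
  have hd : ∀ i, inner ℝ (armVec p i) (armVec p i) = inner ℝ (armVec q i) (armVec q i) := by
    intro i
    rw [real_inner_self_eq_norm_sq, real_inner_self_eq_norm_sq, norm_armVec, norm_armVec]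
  obtain ⟨p0, p1, p2⟩ := gramPoint_apply p
  obtain ⟨q0, q1, q2⟩ := gramPoint_apply q
  have h0 := p0.symm.trans ((congrArg (fun y : E 3 => y 0) h).trans q0)
  have h1 := p1.symm.trans ((congrArg (fun y : E 3 => y 1) h).trans q1)
  have h2 := p2.symm.trans ((congrArg (fun y : E 3 => y 2) h).trans q2)
  fin_cases i <;> fin_cases j
  · exact hd 0
  · exact h2
  · exact h1
  · exact (real_inner_comm _ _).trans (h2.trans (real_inner_comm _ _))
  · exact hd 1
  · exact h0
  · exact (real_inner_comm _ _).trans (h1.trans (real_inner_comm _ _))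
  · exact (real_inner_comm _ _).trans (h0.trans (real_inner_comm _ _))
  · exact hd 2

theorem abs_det_eq_one (A : E 3 ≃ₗᵢ[ℝ] E 3) :
    |LinearMap.det (A.toLinearEquiv : E 3 →ₗ[ℝ] E 3)| = 1 := by
  rw [← LinearMap.normDet_eq_abs_det]
  exact LinearIsometry.normDet_eq_one A.toLinearIsometry

/-- An arm is determined up to orientation preserving isometry by its Gram matrix and its signed
volume. If the volume vanishes, the isometry is corrected, if necessary, by a reflection in a plane
containing the directions of the arm. -/
theorem chain_equiv_of_gramPoint_eq {p q : Chain l 3} (hg : gramPoint p = gramPoint q)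
    (hV : chainVolume p = chainVolume q) : p ≈ q := by
  suffices h : ∃ A : E 3 ≃ₗᵢ[ℝ] E 3, 0 < LinearMap.det (A.toLinearEquiv : E 3 →ₗ[ℝ] E 3) ∧
      ∀ i, A (armVec p i) = armVec q i by
    obtain ⟨A, hA, h⟩ := h
    let g : E 3 ≃ᵃⁱ[ℝ] E 3 := A.toAffineIsometryEquiv.trans
      (AffineIsometryEquiv.constVAdd ℝ (E 3) (q.1 0 - A (p.1 0)))
    have hg : ∀ x, g x = q.1 0 - A (p.1 0) + A x := fun x => rfl
    refine ⟨g, hA, fun i => ?_⟩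
    induction i using Fin.induction with
    | zero => rw [hg, sub_add_cancel]
    | succ i ih =>
      have hp : p.1 i.succ = armVec p i + p.1 i.castSucc := (sub_add_cancel _ _).symm
      have hq : q.1 i.succ = armVec q i + q.1 i.castSucc := (sub_add_cancel _ _).symm
      rw [hg] at ih ⊢
      rw [hp, hq, map_add, h, ← ih]
      abel
  obtain ⟨A, hA⟩ := exists_linearIsometryEquiv_of_inner_eq (inner_armVec_eq hg)
  rcases (abs_eq zero_le_one).1 (abs_det_eq_one A) with hdet | hdet
  · exact ⟨A, by rw [hdet]; exact one_pos, hA⟩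
  have hq0 : chainVolume q = 0 := by
    have harm : armVec q = (A.toLinearEquiv : E 3 →ₗ[ℝ] E 3) ∘ armVec p :=
      funext fun i => (hA i).symm
    have h1 := chainVolume_eq_det q
    rw [harm, Module.Basis.det_comp, hdet, ← chainVolume_eq_det, hV] at h1
    linarith
  have hK := (chainVolume_eq_zero_iff q).1 hq0
  have hK' : (Submodule.span ℝ (range (armVec q)))ᗮ ≠ ⊥ := by
    rwa [ne_eq, Submodule.orthogonal_eq_bot_iff]
  obtain ⟨n, hn, hn0⟩ := Submodule.exists_mem_ne_zero_of_ne_bot hK'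
  let R : E 3 ≃ₗᵢ[ℝ] E 3 := (ℝ ∙ n)ᗮ.reflection
  have hR : LinearMap.det (R.toLinearEquiv : E 3 →ₗ[ℝ] E 3) = -1 := by
    refine ((ℝ ∙ n)ᗮ.det_reflection).trans ?_
    rw [Submodule.orthogonal_orthogonal, finrank_span_singleton hn0, pow_one]
  refine ⟨A.trans R, ?_, fun i => ?_⟩
  · have : ((A.trans R).toLinearEquiv : E 3 →ₗ[ℝ] E 3) =
        (R.toLinearEquiv : E 3 →ₗ[ℝ] E 3) ∘ₗ (A.toLinearEquiv : E 3 →ₗ[ℝ] E 3) := rfl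
    rw [this, LinearMap.det_comp, hR, hdet]
    norm_num
  · rw [LinearIsometryEquiv.trans_apply, hA]
    refine Submodule.reflection_mem_subspace_eq_self ?_
    rw [Submodule.mem_orthogonal_singleton_iff_inner_left]
    exact hn _ (Submodule.subset_span ⟨i, rfl⟩)

/-- The normalisation of the Gram point: its coordinates divided by the products of the lengths. -/
def normPt (l : Fin 3 → ℝ) (g : E 3) : E 3 :=
  !₂[g 0 / (l 1 * l 2), g 1 / (l 0 * l 2), g 2 / (l 0 * l 1)]

/-- The square of the volume is the determinant of the Gram matrix. -/
theorem chainVolume_sq (hl : ∀ i, 0 < l i) (p : Chain l 3) :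
    chainVolume p ^ 2 = (l 0 * l 1 * l 2) ^ 2 * ellDet (normPt l (gramPoint p)) := by
  have h0 := (hl 0).ne'
  have h1 := (hl 1).ne'
  have h2 := (hl 2).ne'
  obtain ⟨g0, g1, g2⟩ := gramPoint_apply p
  have e : ∀ i, l i ^ 2 = armVec p i 0 ^ 2 + armVec p i 1 ^ 2 + armVec p i 2 ^ 2 := by
    intro i
    rw [← norm_armVec p i, EuclideanSpace.real_norm_sq_eq, Fin.sum_univ_three]
  have hin : ∀ i j, inner ℝ (armVec p i) (armVec p j) =
      armVec p i 0 * armVec p j 0 + armVec p i 1 * armVec p j 1 + armVec p i 2 * armVec p j 2 := by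
    intro i j
    rw [PiLp.inner_apply, Fin.sum_univ_three]
    simp [mul_comm]
  have hE : (l 0 * l 1 * l 2) ^ 2 * ellDet (normPt l (gramPoint p)) =
      l 0 ^ 2 * l 1 ^ 2 * l 2 ^ 2 + 2 * (gramPoint p 0 * gramPoint p 1 * gramPoint p 2) -
        (l 0 ^ 2 * gramPoint p 0 ^ 2 + l 1 ^ 2 * gramPoint p 1 ^ 2 +
          l 2 ^ 2 * gramPoint p 2 ^ 2) := by
    simp only [ellDet, normPt, PiLp.toLp_apply, Matrix.cons_val_zero, Matrix.cons_val_one,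
      Matrix.cons_val]
    field_simp
  rw [hE, g0, g1, g2, hin, hin, hin, e, e, e, chainVolume, Matrix.det_fin_three]
  simp only [Matrix.of_apply]
  ring

theorem normPt_mem (hl : ∀ i, 0 < l i) (p : Chain l 3) : normPt l (gramPoint p) ∈ elliptope := by
  have h0 := hl 0
  have h1 := hl 1
  have h2 := hl 2
  obtain ⟨g0, g1, g2⟩ := gramPoint_apply p
  have key : ∀ i j, |inner ℝ (armVec p i) (armVec p j) / (l i * l j)| ≤ 1 := by
    intro i j
    have hij := mul_pos (hl i) (hl j)
    rw [abs_div, abs_of_pos hij, div_le_one hij, ← norm_armVec p i, ← norm_armVec p j]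
    exact abs_real_inner_le_norm _ _
  refine ⟨fun i => ?_, ?_⟩
  · fin_cases i
    · exact key 1 2
    · exact key 0 2
    · exact key 0 1
  · have h := chainVolume_sq hl p
    have hL : 0 < (l 0 * l 1 * l 2) ^ 2 := by positivity
    by_contra hneg
    have := mul_neg_of_pos_of_neg hL (not_le.1 hneg)
    rw [← h] at this
    exact absurd (sq_nonneg _) (not_le.2 this)

/-- Unit vectors with prescribed Gram matrix and determinant, in triangular form. -/
theorem exists_unit_vectors {x : E 3} (hx : x ∈ elliptope) {v : ℝ} (hv : v ^ 2 = ellDet x) :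
    ∃ u : Fin 3 → E 3, (∀ i, ‖u i‖ = 1) ∧ inner ℝ (u 1) (u 2) = x 0 ∧ inner ℝ (u 0) (u 2) = x 1 ∧
      inner ℝ (u 0) (u 1) = x 2 ∧ Matrix.det (Matrix.of fun i j : Fin 3 => u i j) = v := by
  have hsq : ∀ i, 0 ≤ 1 - x i ^ 2 := fun i => by
    rw [sub_nonneg, sq_le_one_iff_abs_le_one]; exact hx.1 i
  suffices h : ∃ s t r : ℝ, s ^ 2 = 1 - x 2 ^ 2 ∧ x 1 ^ 2 + t ^ 2 + r ^ 2 = 1 ∧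
      x 2 * x 1 + s * t = x 0 ∧ s * r = v by
    obtain ⟨s, t, r, h1, h2, h3, h4⟩ := h
    have hn : ∀ a b c : ℝ, a ^ 2 + b ^ 2 + c ^ 2 = 1 → ‖(!₂[a, b, c] : E 3)‖ = 1 := by
      intro a b c h
      rw [EuclideanSpace.norm_eq, Fin.sum_univ_three]
      simp [h]
    have hi : ∀ a b c a' b' c' : ℝ, inner ℝ (!₂[a, b, c] : E 3) !₂[a', b', c'] =
        a * a' + b * b' + c * c' := by
      intro a b c a' b' c'
      rw [PiLp.inner_apply, Fin.sum_univ_three]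
      simp [mul_comm]
    refine ⟨![!₂[1, 0, 0], !₂[x 2, s, 0], !₂[x 1, t, r]], fun i => ?_, ?_, ?_, ?_, ?_⟩
    · fin_cases i
      · exact hn _ _ _ (by norm_num)
      · exact hn _ _ _ (by linarith)
      · exact hn _ _ _ (by linarith)
    · refine (hi _ _ _ _ _ _).trans ?_
      linarith
    · refine (hi _ _ _ _ _ _).trans ?_
      ring
    · refine (hi _ _ _ _ _ _).trans ?_
      ring
    · rw [Matrix.det_fin_three]
      simp [h4]
  -- if the first two vectors are parallel, the third one is constrained only by `x 1`
  rcases (hsq 2).eq_or_lt with h | h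
  · have hx2 : x 2 ^ 2 = 1 := by linarith
    have hd : ellDet x = -(x 0 - x 1 * x 2) ^ 2 := by
      unfold ellDet
      linear_combination (x 1 ^ 2 - 1) * hx2
    have h0 : x 0 - x 1 * x 2 = 0 := by
      have := hx.2
      rw [hd] at this
      exact pow_eq_zero_iff two_ne_zero |>.1 (le_antisymm (neg_nonneg.1 this) (sq_nonneg _))
    have hv0 : v = 0 := by
      rw [hd, h0] at hv
      exact pow_eq_zero_iff two_ne_zero |>.1 (hv.trans (by norm_num))
    refine ⟨0, √(1 - x 1 ^ 2), 0, ?_, ?_, ?_, ?_⟩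
    · rw [← h]; norm_num
    · rw [Real.sq_sqrt (hsq 1)]; ring
    · linarith
    · rw [hv0, zero_mul]
  · have hs := Real.sqrt_pos.2 h
    have hs2 := Real.sq_sqrt h.le
    set s := √(1 - x 2 ^ 2)
    refine ⟨s, (x 0 - x 1 * x 2) / s, v / s, hs2, ?_, ?_, ?_⟩
    · rw [div_pow, div_pow, hv, hs2, add_assoc, ← add_div, ← eq_sub_iff_add_eq', div_eq_iff h.ne',
        ellDet]
      ring
    · field_simp
      ring
    · field_simp

/-- Every point of the hypersurface `v² = ellDet x` over the elliptope comes from an arm. -/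
theorem exists_chain (hl : ∀ i, 0 < l i) {x : E 3} (hx : x ∈ elliptope) {v : ℝ}
    (hv : v ^ 2 = ellDet x) :
    ∃ p : Chain l 3, normPt l (gramPoint p) = x ∧ chainVolume p = l 0 * l 1 * l 2 * v := by
  obtain ⟨u, hu, h0, h1, h2, hdet⟩ := exists_unit_vectors hx hv
  have hl0 := (hl 0).ne'
  have hl1 := (hl 1).ne'
  have hl2 := (hl 2).ne'
  let pts : Fin 4 → E 3 := ![0, l 0 • u 0, l 0 • u 0 + l 1 • u 1,
    l 0 • u 0 + l 1 • u 1 + l 2 • u 2]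
  have hpts : ∀ i : Fin 3, pts i.succ - pts i.castSucc = l i • u i := by
    intro i
    fin_cases i
    · exact sub_zero _
    · exact add_sub_cancel_left _ _
    · exact add_sub_cancel_left _ _
  let p : Chain l 3 := ⟨pts, fun i => by
    rw [dist_comm, dist_eq_norm, hpts, norm_smul, hu, mul_one, Real.norm_of_nonneg (hl i).le]⟩
  have harm : ∀ i, armVec p i = l i • u i := hpts
  obtain ⟨g0, g1, g2⟩ := gramPoint_apply p
  refine ⟨p, PiLp.ext fun i => ?_, ?_⟩
  · simp only [harm, inner_smul_left, inner_smul_right, h0, h1, h2] at g0 g1 g2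
    fin_cases i
    · change gramPoint p 0 / (l 1 * l 2) = x 0
      rw [g0]
      simp only [conj_trivial]
      field_simp
    · change gramPoint p 1 / (l 0 * l 2) = x 1
      rw [g1]
      simp only [conj_trivial]
      field_simp
    · change gramPoint p 2 / (l 0 * l 1) = x 2
      rw [g2]
      simp only [conj_trivial]
      field_simp
  · rw [← hdet, chainVolume, Matrix.det_fin_three, Matrix.det_fin_three]
    simp only [Matrix.of_apply, harm, PiLp.smul_apply, smul_eq_mul]
    ring

end RobotArm

end

/-! ### The moduli space, the doubled Gram set and the sphere -/

noncomputable section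

namespace RobotArm

open Set Filter Topology

variable {l : Fin 3 → ℝ}

/-- Normalisation of Gram points as a homeomorphism of `ℝ³`. -/
def normHomeo (hl : ∀ i, 0 < l i) : E 3 ≃ₜ E 3 where
  toFun := normPt l
  invFun x := !₂[x 0 * (l 1 * l 2), x 1 * (l 0 * l 2), x 2 * (l 0 * l 1)]
  left_inv g := by
    have h0 := (hl 0).ne'
    have h1 := (hl 1).ne'
    have h2 := (hl 2).ne'
    refine PiLp.ext fun i => ?_
    fin_cases i
    · exact div_mul_cancel₀ _ (mul_ne_zero h1 h2)
    · exact div_mul_cancel₀ _ (mul_ne_zero h0 h2)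
    · exact div_mul_cancel₀ _ (mul_ne_zero h0 h1)
  right_inv g := by
    have h0 := (hl 0).ne'
    have h1 := (hl 1).ne'
    have h2 := (hl 2).ne'
    refine PiLp.ext fun i => ?_
    fin_cases i
    · exact mul_div_cancel_right₀ _ (mul_ne_zero h1 h2)
    · exact mul_div_cancel_right₀ _ (mul_ne_zero h0 h2)
    · exact mul_div_cancel_right₀ _ (mul_ne_zero h0 h1)
  continuous_toFun := by
    refine (PiLp.continuous_toLp 2 _).comp (continuous_pi fun i => ?_)
    fin_cases i <;> exact (PiLp.continuous_apply 2 _ _).div_const _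
  continuous_invFun := by
    refine (PiLp.continuous_toLp 2 _).comp (continuous_pi fun i => ?_)
    fin_cases i <;> exact (PiLp.continuous_apply 2 _ _).mul continuous_const

/-- The Gram set is the elliptope up to normalisation. -/
theorem gramSet_eq (hl : ∀ i, 0 < l i) : gramSet l = normHomeo hl ⁻¹' elliptope := by
  ext g
  constructor
  · rintro ⟨p, rfl⟩
    exact normPt_mem hl p
  · intro hg
    obtain ⟨p, hp, -⟩ := exists_chain hl hg (Real.sq_sqrt hg.2)
    exact ⟨p, (normHomeo hl).injective hp⟩

theorem mem_frontier_gramSet_iff (hl : ∀ i, 0 < l i) {g : E 3} (hg : g ∈ gramSet l) :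
    g ∈ frontier (gramSet l) ↔ ellDet (normPt l g) = 0 := by
  rw [gramSet_eq hl] at hg
  rw [gramSet_eq hl, ← (normHomeo hl).preimage_frontier, mem_preimage, frontier_elliptope_iff hg]
  rfl

theorem chainVolume_eq_zero_iff_ellDet (hl : ∀ i, 0 < l i) (p : Chain l 3) :
    chainVolume p = 0 ↔ ellDet (normPt l (gramPoint p)) = 0 := by
  have hL : (l 0 * l 1 * l 2) ^ 2 ≠ 0 :=
    pow_ne_zero 2 (mul_pos (mul_pos (hl 0) (hl 1)) (hl 2)).ne'
  rw [← pow_eq_zero_iff two_ne_zero, chainVolume_sq hl, mul_eq_zero, or_iff_right hL]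

theorem span_armVec (p : Chain l 3) :
    Submodule.span ℝ (range (armVec p)) = vectorSpan ℝ (range p.1) := by
  refine le_antisymm (Submodule.span_le.2 ?_) ?_
  · rintro _ ⟨i, rfl⟩
    exact vsub_mem_vectorSpan ℝ (mem_range_self _) (mem_range_self _)
  · rw [vectorSpan_range_eq_span_range_vsub_right ℝ p.1 0, Submodule.span_le]
    rintro _ ⟨i, rfl⟩
    change p.1 i - p.1 0 ∈ Submodule.span ℝ (range (armVec p))
    induction i using Fin.induction with
    | zero => rw [sub_self]; exact zero_mem _
    | succ i ih =>
      have : p.1 i.succ - p.1 0 = armVec p i + (p.1 i.castSucc - p.1 0) :=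
        (sub_add_sub_cancel _ _ _).symm
      rw [this]
      exact add_mem (Submodule.subset_span ⟨i, rfl⟩) ih

theorem coplanar_iff_chainVolume_eq_zero (p : Chain l 3) :
    Coplanar ℝ (range p.1) ↔ chainVolume p = 0 := by
  rw [chainVolume_eq_zero_iff, coplanar_iff_finrank_le_two, ← span_armVec]
  have hfin : Module.finrank ℝ (E 3) = 3 := by simp
  constructor
  · intro h htop
    rw [htop, finrank_top, hfin] at h
    omega
  · intro h
    have := Submodule.finrank_lt h
    omega

theorem normVolume_sq (hl : ∀ i, 0 < l i) (p : Chain l 3) :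
    (chainVolume p / (l 0 * l 1 * l 2)) ^ 2 = ellDet (normPt l (gramPoint p)) := by
  have hL := (mul_pos (mul_pos (hl 0) (hl 1)) (hl 2)).ne'
  rw [div_pow, chainVolume_sq hl, mul_div_cancel_left₀ _ (pow_ne_zero 2 hL)]

/-- The invariant that identifies the moduli space with the sphere. -/
def armSph (hl : ∀ i, 0 < l i) (p : Chain l 3) : S3 :=
  ⟨sph (normPt l (gramPoint p)) (chainVolume p / (l 0 * l 1 * l 2)),
    sph_mem (normPt_mem hl p) (normVolume_sq hl p)⟩

theorem continuous_armSph (hl : ∀ i, 0 < l i) : Continuous (armSph hl) := by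
  refine Continuous.subtype_mk (continuous_sph ((normHomeo hl).continuous.comp
    continuous_gramPoint) (continuous_chainVolume.div_const _) fun p => normVolume_sq hl p) _

theorem armSph_eq_iff (hl : ∀ i, 0 < l i) (p q : Chain l 3) :
    armSph hl p = armSph hl q ↔ p ≈ q := by
  have hL := (mul_pos (mul_pos (hl 0) (hl 1)) (hl 2)).ne'
  constructor
  · intro h
    obtain ⟨h1, h2⟩ := sph_injOn (normPt_mem hl p) (normVolume_sq hl p) (normPt_mem hl q)
      (normVolume_sq hl q) (congrArg Subtype.val h)
    exact chain_equiv_of_gramPoint_eq ((normHomeo hl).injective h1)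
      ((div_left_inj' hL).1 h2)
  · intro h
    have hV := chainVolume_congr p q h
    obtain ⟨g, -, hg⟩ := h
    have harm : ∀ i, armVec q i = g.linearIsometryEquiv (armVec p i) := fun i => by
      simp only [armVec, ← hg]
      exact (g.map_vsub _ _).symm
    have hG : gramPoint p = gramPoint q := by
      obtain ⟨p0, p1, p2⟩ := gramPoint_apply p
      obtain ⟨q0, q1, q2⟩ := gramPoint_apply q
      simp only [harm, LinearIsometryEquiv.inner_map_map] at q0 q1 q2
      refine PiLp.ext fun i => ?_
      fin_cases i
      · exact p0.trans q0.symm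
      · exact p1.trans q1.symm
      · exact p2.trans q2.symm
    refine Subtype.ext ?_
    change sph _ _ = sph _ _
    rw [hG, hV]

theorem armSph_surjective (hl : ∀ i, 0 < l i) : Function.Surjective (armSph hl) := by
  have hL := (mul_pos (mul_pos (hl 0) (hl 1)) (hl 2)).ne'
  intro q
  obtain ⟨x, hx, hv, hq⟩ := exists_sph_eq q
  obtain ⟨p, hp, hV⟩ := exists_chain hl hx hv
  refine ⟨p, Subtype.ext ?_⟩
  change sph _ _ = _
  rw [hp, hV, mul_div_cancel_left₀ _ hL, hq]

/-- Every arm can be translated so that it starts at the origin, and the arms starting there form a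
compact set. -/
theorem compactSpace_moduli (hl : ∀ i, 0 < l i) : CompactSpace (Moduli l 3) := by
  let B : Set (Fin 4 → E 3) := {p | p 0 = 0 ∧ ∀ i : Fin 3, dist (p i.castSucc) (p i.succ) = l i}
  have hclosed : IsClosed B := by
    have : B = {p | p 0 = 0} ∩ ⋂ i : Fin 3, {p | dist (p i.castSucc) (p i.succ) = l i} := by
      ext p; simp [B]
    rw [this]
    exact (isClosed_eq (continuous_apply 0) continuous_const).inter
      (isClosed_iInter fun i => isClosed_eq
        ((continuous_apply _).dist (continuous_apply _)) continuous_const)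
  have hbdd : B ⊆ Metric.closedBall 0 (l 0 + l 1 + l 2) := by
    rintro p ⟨hp0, hp⟩
    have h0 := hl 0
    have h1 := hl 1
    have h2 := hl 2
    have hstep : ∀ i : Fin 3, ‖p i.succ‖ ≤ ‖p i.castSucc‖ + l i := by
      intro i
      rw [← hp i, dist_comm, dist_eq_norm]
      exact norm_le_norm_add_norm_sub' _ _
    have e0 : ‖p 0‖ = 0 := by rw [hp0, norm_zero]
    have e1 : ‖p 1‖ ≤ ‖p 0‖ + l 0 := hstep 0
    have e2 : ‖p 2‖ ≤ ‖p 1‖ + l 1 := hstep 1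
    have e3 : ‖p 3‖ ≤ ‖p 2‖ + l 2 := hstep 2
    rw [mem_closedBall_zero_iff, pi_norm_le_iff_of_nonneg (by positivity)]
    intro i
    fin_cases i
    · change ‖p 0‖ ≤ _; linarith
    · change ‖p 1‖ ≤ _; linarith
    · change ‖p 2‖ ≤ _; linarith
    · change ‖p 3‖ ≤ _; linarith
  have hB : IsCompact B := (isCompact_closedBall _ _).of_isClosed_subset hclosed hbdd
  have hcB : CompactSpace B := isCompact_iff_compactSpace.1 hB
  let F : B → Moduli l 3 := fun p => ⟦⟨p.1, p.2.2⟩⟧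
  have hF : Continuous F := continuous_quotient_mk'.comp
    (continuous_subtype_val.subtype_mk _)
  refine Function.Surjective.compactSpace (f := F) hF fun R => ?_
  induction R using Quotient.inductionOn with
  | h p =>
    refine ⟨⟨fun i => p.1 i - p.1 0, sub_self _, fun i => ?_⟩, Quotient.sound ?_⟩
    · rw [dist_sub_right]; exact p.2 i
    · refine ⟨AffineIsometryEquiv.constVAdd ℝ (E 3) (p.1 0), ?_, fun i => ?_⟩
      -- the linear part of a translation is the identity
      · exact OrientationPreserving.refl
      · exact add_sub_cancel _ _

/-- The moduli space is homeomorphic to the sphere, the signed volume becoming the height up to a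
factor. -/
def moduliHomeo (hl : ∀ i, 0 < l i) : Moduli l 3 ≃ₜ S3 :=
  haveI := compactSpace_moduli hl
  Continuous.homeoOfEquivCompactToT2
    (f := Equiv.ofBijective
      (Quotient.lift (armSph hl) fun p q h => (armSph_eq_iff hl p q).2 h)
      ⟨by
        intro P Q
        induction P using Quotient.inductionOn
        induction Q using Quotient.inductionOn
        exact fun h => Quotient.sound ((armSph_eq_iff hl _ _).1 h), fun q => by
        obtain ⟨p, hp⟩ := armSph_surjective hl q
        exact ⟨⟦p⟧, hp⟩⟩)
    ((continuous_armSph hl).quotient_lift _)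

theorem moduliHomeo_mk (hl : ∀ i, 0 < l i) (p : Chain l 3) : moduliHomeo hl ⟦p⟧ = armSph hl p := rfl

theorem volume_eq (hl : ∀ i, 0 < l i) (R : Moduli l 3) :
    volume l R = l 0 * l 1 * l 2 * (moduliHomeo hl R).1 3 := by
  have hL := (mul_pos (mul_pos (hl 0) (hl 1)) (hl 2)).ne'
  induction R using Quotient.inductionOn with
  | h p =>
    rw [moduliHomeo_mk]
    change chainVolume p = l 0 * l 1 * l 2 * sph _ _ 3
    rw [sph_last, mul_div_cancel₀ _ hL]

theorem normPt_coe_mem (hl : ∀ i, 0 < l i) (g : gramSet l) : normPt l g ∈ elliptope :=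
  (Set.ext_iff.1 (gramSet_eq hl) g).1 g.2

theorem sheet_sq (hl : ∀ i, 0 < l i) {s : ℝ} (hs : s ^ 2 = 1) (g : gramSet l) :
    (s * √(ellDet (normPt l g))) ^ 2 = ellDet (normPt l g) := by
  rw [mul_pow, hs, one_mul, Real.sq_sqrt (normPt_coe_mem hl g).2]

/-- The lift of a copy of the Gram set to the hemisphere of `S³` selected by the sign `s`. -/
def sheetSph (hl : ∀ i, 0 < l i) (s : ℝ) (hs : s ^ 2 = 1) (g : gramSet l) : S3 :=
  ⟨sph (normPt l g) (s * √(ellDet (normPt l g))),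
    sph_mem (normPt_coe_mem hl g) (sheet_sq hl hs g)⟩

theorem continuous_sheetSph (hl : ∀ i, 0 < l i) (s : ℝ) (hs : s ^ 2 = 1) :
    Continuous (sheetSph hl s hs) := by
  have hc : Continuous fun g : gramSet l => normPt l g :=
    (normHomeo hl).continuous.comp continuous_subtype_val
  exact Continuous.subtype_mk (continuous_sph hc (continuous_const.mul
    (continuous_ellDet.comp hc).sqrt) fun g => sheet_sq hl hs g) _

/-- The map from the double of the Gram set to the sphere, before gluing. -/
def doubleSph (hl : ∀ i, 0 < l i) : gramSet l ⊕ gramSet l → S3 :=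
  Sum.elim (sheetSph hl 1 (by norm_num)) (sheetSph hl (-1) (by norm_num))

theorem doubleSph_eq_of_glueRel (hl : ∀ i, 0 < l i) (u w : gramSet l ⊕ gramSet l)
    (h : GlueRel (gramSet l) u w) : doubleSph hl u = doubleSph hl w := by
  have key : ∀ s : gramSet l, (s : E 3) ∈ frontier (gramSet l) →
      doubleSph hl (Sum.inl s) = doubleSph hl (Sum.inr s) := by
    intro s hs
    rw [mem_frontier_gramSet_iff hl s.2] at hs
    refine Subtype.ext ?_
    change sph _ (1 * √_) = sph _ (-1 * √_)
    rw [hs, Real.sqrt_zero, mul_zero, mul_zero]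
  cases h with
  | refl => rfl
  | inl_inr s hs => exact key s hs
  | inr_inl s hs => exact (key s hs).symm

theorem glueRel_of_doubleSph_eq (hl : ∀ i, 0 < l i) (u w : gramSet l ⊕ gramSet l)
    (h : doubleSph hl u = doubleSph hl w) : GlueRel (gramSet l) u w := by
  have key : ∀ {s t : ℝ} (hs : s ^ 2 = 1) (ht : t ^ 2 = 1) (g g' : gramSet l),
      sheetSph hl s hs g = sheetSph hl t ht g' →
        g = g' ∧ s * √(ellDet (normPt l g)) = t * √(ellDet (normPt l g)) := by
    intro s t hs ht g g' h
    obtain ⟨h1, h2⟩ := sph_injOn (normPt_coe_mem hl g) (sheet_sq hl hs g) (normPt_coe_mem hl g')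
      (sheet_sq hl ht g') (congrArg Subtype.val h)
    have hgg : g = g' := Subtype.ext ((normHomeo hl).injective h1)
    exact ⟨hgg, by rw [h2, ← hgg]⟩
  have hfr : ∀ g : gramSet l, √(ellDet (normPt l g)) = 0 → (g : E 3) ∈ frontier (gramSet l) := by
    intro g hg
    rw [mem_frontier_gramSet_iff hl g.2]
    exact (Real.sqrt_eq_zero (normPt_coe_mem hl g).2).1 hg
  rcases u with g | g <;> rcases w with g' | g'
  · obtain ⟨rfl, -⟩ := key (s := 1) (t := 1) (by norm_num) (by norm_num) g g' h
    exact .refl _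
  · obtain ⟨rfl, h2⟩ := key (s := 1) (t := -1) (by norm_num) (by norm_num) g g' h
    exact .inl_inr g (hfr g (by linarith))
  · obtain ⟨rfl, h2⟩ := key (s := -1) (t := 1) (by norm_num) (by norm_num) g g' h
    exact .inr_inl g (hfr g (by linarith))
  · obtain ⟨rfl, -⟩ := key (s := -1) (t := -1) (by norm_num) (by norm_num) g g' h
    exact .refl _

/-- The value of the sphere invariant of an arm is the one of its Gram point, in the sheet given by
the sign of the volume. -/
theorem doubleSph_gramPoint (hl : ∀ i, 0 < l i) (p : Chain l 3) :
    (0 ≤ chainVolume p → doubleSph hl (Sum.inl ⟨gramPoint p, mem_range_self p⟩) = armSph hl p) ∧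
    (chainVolume p ≤ 0 → doubleSph hl (Sum.inr ⟨gramPoint p, mem_range_self p⟩) = armSph hl p) := by
  have hL := mul_pos (mul_pos (hl 0) (hl 1)) (hl 2)
  refine ⟨fun h => Subtype.ext ?_, fun h => Subtype.ext ?_⟩
  · change sph _ (1 * √(ellDet (normPt l (gramPoint p)))) = sph _ _
    rw [← normVolume_sq hl, Real.sqrt_sq (div_nonneg h hL.le), one_mul]
  · change sph _ (-1 * √(ellDet (normPt l (gramPoint p)))) = sph _ _
    rw [← normVolume_sq hl, ← neg_sq, Real.sqrt_sq
      (neg_nonneg.2 (div_nonpos_of_nonpos_of_nonneg h hL.le)), neg_one_mul, neg_neg]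

theorem compactSpace_gramSet (hl : ∀ i, 0 < l i) : CompactSpace (gramSet l) := by
  have hb : elliptope ⊆ Metric.closedBall (0 : E 3) 2 := by
    intro x hx
    have h : ∀ i, x i ^ 2 ≤ 1 := fun i => (sq_le_one_iff_abs_le_one _).2 (hx.1 i)
    rw [mem_closedBall_zero_iff]
    have h2 : ‖x‖ ^ 2 ≤ 2 ^ 2 := by
      rw [EuclideanSpace.real_norm_sq_eq, Fin.sum_univ_three]
      linarith [h 0, h 1, h 2]
    exact (pow_le_pow_iff_left₀ (norm_nonneg _) zero_le_two two_ne_zero).1 h2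
  have hc : IsCompact elliptope :=
    (isCompact_closedBall _ _).of_isClosed_subset isClosed_elliptope hb
  rw [← isCompact_iff_compactSpace, gramSet_eq hl]
  exact (normHomeo hl).isCompact_preimage.2 hc

/-- The double of the Gram set is homeomorphic to the sphere. -/
def doubleHomeo (hl : ∀ i, 0 < l i) : Double (gramSet l) ≃ₜ S3 :=
  haveI := compactSpace_gramSet hl
  Continuous.homeoOfEquivCompactToT2
    (f := Equiv.ofBijective
      (Quot.lift (doubleSph hl) (doubleSph_eq_of_glueRel hl))
      ⟨by
        intro P Q
        induction P using Quot.inductionOn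
        induction Q using Quot.inductionOn
        exact fun h => Quot.sound (glueRel_of_doubleSph_eq hl _ _ h), fun q => by
        obtain ⟨p, rfl⟩ := armSph_surjective hl q
        rcases le_total 0 (chainVolume p) with h | h
        · exact ⟨Quot.mk _ (Sum.inl _), (doubleSph_gramPoint hl p).1 h⟩
        · exact ⟨Quot.mk _ (Sum.inr _), (doubleSph_gramPoint hl p).2 h⟩⟩)
    (continuous_quot_lift _
      ((continuous_sheetSph hl 1 _).sumElim (continuous_sheetSph hl (-1) _)))

end RobotArm

end

theorem mainTheorem2 (l : Fin 3 → ℝ) (hl : ∀ i, 0 < l i) :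
    -- the moduli space is a 3-sphere
    Nonempty (RobotArm.Moduli l 3 ≃ₜ Metric.sphere (0 : EuclideanSpace ℝ (Fin 4)) 1) ∧
    -- it is glued from two copies of the Gram set (the parts `0 ≤ V` and `V ≤ 0`)
    -- along their boundary
    (∃ Φ : RobotArm.Moduli l 3 ≃ₜ RobotArm.Double (RobotArm.gramSet l),
      ∀ p : RobotArm.Chain l 3,
        (0 ≤ RobotArm.chainVolume p →
          Φ ⟦p⟧ = Quot.mk _ (Sum.inl ⟨RobotArm.gramPoint p, Set.mem_range_self p⟩)) ∧
        (RobotArm.chainVolume p ≤ 0 →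
          Φ ⟦p⟧ = Quot.mk _ (Sum.inr ⟨RobotArm.gramPoint p, Set.mem_range_self p⟩))) ∧
    -- which consists of the degenerate arms
    (∀ p : RobotArm.Chain l 3,
      RobotArm.gramPoint p ∈ frontier (RobotArm.gramSet l) ↔ Coplanar ℝ (Set.range p.1)) ∧
    -- the signed volume is an exact topological Morse function
    RobotArm.IsExactTopMorse 3 (RobotArm.volume l) ∧
    -- with exactly two critical points, a maximum and a minimum
    (∃ P Q : RobotArm.Moduli l 3, P ≠ Q ∧
      {R : RobotArm.Moduli l 3 | RobotArm.IsTopCriticalPoint 3 (RobotArm.volume l) R} = {P, Q} ∧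
      RobotArm.IsMorseCriticalPoint 3 (RobotArm.volume l) 3 P ∧
      (∀ R, RobotArm.volume l R ≤ RobotArm.volume l P) ∧
      RobotArm.IsMorseCriticalPoint 3 (RobotArm.volume l) 0 Q ∧
      (∀ R, RobotArm.volume l Q ≤ RobotArm.volume l R)) := by
  refine ⟨⟨RobotArm.moduliHomeo hl⟩, ⟨(RobotArm.moduliHomeo hl).trans
    (RobotArm.doubleHomeo hl).symm, fun p => ⟨fun h => ?_, fun h => ?_⟩⟩, fun p => ?_,
    RobotArm.exactTopMorse_of_height (RobotArm.moduliHomeo hl)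
      (mul_pos (mul_pos (hl 0) (hl 1)) (hl 2)) (RobotArm.volume_eq hl)⟩
  · exact (RobotArm.doubleHomeo hl).symm_apply_eq.2 ((RobotArm.doubleSph_gramPoint hl p).1 h).symm
  · exact (RobotArm.doubleHomeo hl).symm_apply_eq.2 ((RobotArm.doubleSph_gramPoint hl p).2 h).symm
  · rw [RobotArm.coplanar_iff_chainVolume_eq_zero,
      RobotArm.mem_frontier_gramSet_iff hl (Set.mem_range_self p),
      RobotArm.chainVolume_eq_zero_iff_ellDet hl]
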